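/- Let ${\bf k}$ be an algebraically closed field, $N$ a lattice, and $\Sigma$ a finite smooth fan in $N_{\mathbb Q}$ with primitive ray generators $\rho_1,\dots,\rho_n$, listed in an arbitrary order. For a quasivaluation $v:R\to\mathbb Z\cup\{\infty\}$ put $G_r(v)=\{f : v(f)\ge r\}$ and $\operatorname{gr}_v(R)=\bigoplus_r G_r(v)/G_{>r}(v)$, and write $\bar f\in\operatorname{gr}_v(R)$ for the initial form of $f$ (with $\bar f=0$ if $v(f)=\infty$). **Setting.** Let $A=\bigoplus_{d\ge 0}A_d$ be a commutative graded ${\bf k}$-algebra with finite-dimensional pieces $A_d$, and let $\mathfrak v$ be a quasivaluation on $A$ with values in $\mathbb Z\cup\{\infty\}$-valued functions on $|\Sigma|\cap N$, i.e. a family of quasivaluations $\mathfrak v_x:A\to\mathbb Z\cup\{\infty\}$, $x\in|\Sigma|\cap N$. Assume that $(A,\mathfrak v)$ is a flat toric sheaf of algebras: $\mathfrak v_x(f)=\min_d \mathfrak v_x(f_d)$ for $f=\sum_d f_d$, $f_d\in A_d$; and for every cone $\sigma\in\Sigma$ there are a basis $(b_i)$ of $A$ and linear forms $m_i\in\operatorname{Hom}(N,\mathbb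 Z)$ with $\mathfrak v_x(\sum_i c_ib_i)=\min_{c_i\ne0} m_i(x)$ for all $x\in\sigma\cap N$. For an integral piecewise linear function $\psi$ on $\Sigma$ let $F_\psi(\mathfrak v)=\{f\in A : \mathfrak v_x(f)\ge\psi(x)\ \forall x\in|\Sigma|\cap N\}$, and let $\mathcal R(A,\hat{\mathfrak v})=\bigoplus_\psi F_\psi(\mathfrak v)\,t^\psi$ be the total section ring. A subset of $A$ is a *strong Khovanskii basis* of $(A,\mathfrak v)$ if it is the image, under $t^\psi\mapsto1$, of a set of homogeneous (i.e. of the form $a\,t^\psi$) generators of the ${\bf k}$-algebra $\mathcal R(A,\hat{\mathfrak v})$. **Algorithm.** Input: a finite set of homogeneous generators of $A$. Each $\mathfrak v_{\rho_j}$ is extended to $A[t_1^{\pm1},\dots,t_n^{\pm1}]$ by $\mathfrak v_{\rho_j}(\sum_r a_rt^r)=\min_r\mathfrak v_{\rho_j}(a_r)$. Let $\mathcal B_0$ be the input, and let $R_j=\bigoplus_{r\in\mathbb Z^j}\big(\bigcap_{i\le j}G_{r_i}(\mathfrak v_{\rho_i})\big)t^r$, so that $R_0=A$ and $R_{j+1}$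 is the Rees algebra of $(R_j,\mathfrak v_{\rho_{j+1}})$. For $j=0,\dots,n-1$, starting with $\mathcal B=\mathcal B_j\subset R_j$ and $v=\mathfrak v_{\rho_{j+1}}$, repeat the following pass: 1. choose a finite set $G$ of generators of the ideal $J_{\mathcal B}$ of polynomial relations among the initial forms $\bar b$, $b\in\mathcal B$; 2. for every $g\in G$ put $h=g(\mathcal B)$; as long as $h\ne0$ and $\bar h$ is a polynomial $p$ in the initial forms of the current $\mathcal B$, choose such a $p$ and replace $h$ by $h-p(\mathcal B)$; if $h\neq 0$ and $\bar h$ is not such a polynomial, add $h$ to $\mathcal B$ and go on to the next $g$; if $h=0$, go on to the next $g$; 3. if the pass has enlarged $\mathcal B$, begin a new pass; otherwise put $\mathcal B_{j+1}=\{b\,t_{j+1}^{v(b)} : b\in\mathcal B,\ b\ne0\}\cup\{t_{j+1}^{-1}\}$ (an element $b=0$, if present, contributes $0$) and go on to $j+1$. The output is $\mathcal B_n$. The polynomials $g$ and $p$ are chosen homogeneous for the grading of $A$, for the $\mathbb Z^n$-grading and for the weight in which the variable of $b$ has weight $v(b)$, the weight of $p$ being $v(h)$; otherwise all choices are free. The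 algorithm *terminates* if every run is finite and ends with an output. **Statement.** (a) For every finite set of homogeneous generators of $A$ as input, every generating set that the algorithm has at the beginning of a pass of stage $j$ (and its output, for $j=n$) generates the ${\bf k}$-algebra $R_j$, and the following are equivalent: the algorithm terminates; some run of the algorithm ends with an output; $(A,\mathfrak v)$ has a finite strong Khovanskii basis. (b) Let $\mathcal E$ be a toric vector bundle over the toric variety of $\Sigma$, given by a finite-dimensional space $E$ and a prevaluation of $E$ with values in functions on $|\Sigma|\cap N$ that has, on every cone $\sigma\in\Sigma$, a linear adapted basis (in the sense above). Let $\mathfrak v$ be the induced quasivaluation of $\operatorname{Sym}(E)$: $G_r(\mathfrak v_x)$ is spanned by the products $e_1\cdots e_m$ of elements of $E$ with $\sum_i\mathfrak v_x(e_i)\ge r$. Then, for every finite set of homogeneous generators of $\operatorname{Sym}(E)$ as input, the following are equivalent: the algorithm for $(\operatorname{Sym}(E),\mathfrak v)$ terminates; some run of it ends with an output; the Cox ring $\mathcal R(\mathcal E)=\mathcal R(\operatorname{Sym}(E),\hat{\mathfrak v})$ of the projectivization of $\mathcal E$ is a finitely generated ${\bf k}$-algebra. -/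

import Mathlib

noncomputable section

namespace StrongKhovanskii

universe u

/-! ### Valuations -/

/-- A prevaluation on a `k`-vector space with values in `ℤ ∪ {∞}`. -/
structure Prevaluation (k E : Type*) [Field k] [AddCommGroup E] [Module k E] where
  /-- the value of a vector -/
  val : E → WithTop ℤ
  val_zero : val 0 = ⊤
  val_add : ∀ f g, min (val f) (val g) ≤ val (f + g)
  val_smul : ∀ (c : k) (f : E), c ≠ 0 → val (c • f) = val f

/-- A quasivaluation on a `k`-algebra with values in `ℤ ∪ {∞}`. -/
structure Quasivaluation (k A : Type*) [Field k] [CommRing A] [Algebra k A] where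
  /-- the value of an element -/
  val : A → WithTop ℤ
  val_mul : ∀ f g, val f + val g ≤ val (f * g)
  val_add : ∀ f g, min (val f) (val g) ≤ val (f + g)
  val_const : ∀ c : k, c ≠ 0 → val (algebraMap k A c) = 0
  val_zero : val 0 = ⊤

/-- The subalgebra `⨁ᵣ P r · tʳ` of `A[t^Γ] = A ⊗ k[Γ]` attached to a multiplicative family of
subspaces `P r` of `A`. -/
def gradedSubalgebra {k A Γ : Type*} [Field k] [CommRing A] [Algebra k A] [AddCommMonoid Γ]
    (P : Γ → Submodule k A) (one_mem : (1 : A) ∈ P 0)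
    (mul_mem : ∀ r s a b, a ∈ P r → b ∈ P s → a * b ∈ P (r + s)) :
    Subalgebra k (AddMonoidAlgebra A Γ) where
  carrier := {f | ∀ r, f.coeff r ∈ P r}
  add_mem' := fun {f g} hf hg r => by
    rw [AddMonoidAlgebra.coeff_add, Finsupp.add_apply]
    exact (P r).add_mem (hf r) (hg r)
  mul_mem' := fun {f g} hf hg r => by
    classical
    rw [AddMonoidAlgebra.coeff_mul]
    refine (P r).sum_mem fun a _ => (P r).sum_mem fun b _ => ?_
    dsimp only
    split_ifs with h
    · exact h ▸ mul_mem a b _ _ (hf a) (hg b)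
    · exact (P r).zero_mem
  algebraMap_mem' := fun c r => by
    classical
    have h : algebraMap k (AddMonoidAlgebra A Γ) c = AddMonoidAlgebra.single 0 (algebraMap k A c) :=
      rfl
    rw [h, AddMonoidAlgebra.coeff_single, Finsupp.single_apply]
    split_ifs with h0
    · subst h0
      rw [Algebra.algebraMap_eq_smul_one]
      exact (P 0).smul_mem c one_mem
    · exact (P r).zero_mem

lemma le_of_forall_int_le {a b : WithTop ℤ} (h : ∀ s : ℤ, (s : WithTop ℤ) ≤ a → (s : WithTop ℤ) ≤ b) :
    a ≤ b := by
  induction b using WithTop.recTopCoe with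
  | top => exact le_top
  | coe b =>
    induction a using WithTop.recTopCoe with
    | top =>
      have := h (b + 1) le_top
      rw [WithTop.coe_le_coe] at this
      omega
    | coe a => exact h a le_rfl

namespace Quasivaluation

variable {k A : Type*} [Field k] [CommRing A] [Algebra k A]

lemma val_one (v : Quasivaluation k A) : v.val 1 = 0 := by
  simpa using v.val_const 1 one_ne_zero

lemma le_val_smul (v : Quasivaluation k A) (c : k) (f : A) : v.val f ≤ v.val (c • f) := by
  by_cases hc : c = 0
  · simp [hc, v.val_zero]
  · have := v.val_mul (algebraMap k A c) f
    rwa [v.val_const c hc, zero_add, ← Algebra.smul_def] at this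

/-- The prevaluation underlying a quasivaluation. -/
def toPrevaluation (v : Quasivaluation k A) : Prevaluation k A where
  val := v.val
  val_zero := v.val_zero
  val_add := v.val_add
  val_smul := fun c f hc => le_antisymm
    (by simpa [smul_smul, inv_mul_cancel₀ hc] using v.le_val_smul c⁻¹ (c • f)) (v.le_val_smul c f)

/-- The filtration step `G_r = {f ∣ v f ≥ r}`. -/
def level (v : Quasivaluation k A) (r : ℤ) : Submodule k A where
  carrier := {f | (r : WithTop ℤ) ≤ v.val f}
  add_mem' := fun {f g} hf hg => (le_min hf hg).trans (v.val_add f g)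
  zero_mem' := by simp [v.val_zero]
  smul_mem' := fun c f hf => le_trans hf (v.le_val_smul c f)

lemma mem_level (v : Quasivaluation k A) (r : ℤ) (f : A) :
    f ∈ v.level r ↔ (r : WithTop ℤ) ≤ v.val f := Iff.rfl

lemma mul_mem_level (v : Quasivaluation k A) {r s : ℤ} {f g : A} (hf : f ∈ v.level r)
    (hg : g ∈ v.level s) : f * g ∈ v.level (r + s) := by
  rw [mem_level] at *
  push_cast
  exact (add_le_add hf hg).trans (v.val_mul f g)

lemma one_mem_level (v : Quasivaluation k A) : (1 : A) ∈ v.level 0 := by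
  simp [mem_level, v.val_one]

/-- The quasivaluation of a decreasing, exhaustive, multiplicative filtration `G` with
`1 ∈ G₀ ∖ G₁`: the value of `f` is `max {r ∣ f ∈ G_r}`, and `∞` if the maximum is not attained. -/
def ofFiltration (G : ℤ → Submodule k A) (anti : Antitone G) (exh : ∀ f, ∃ r, f ∈ G r)
    (mul : ∀ r s f g, f ∈ G r → g ∈ G s → f * g ∈ G (r + s)) (one : (1 : A) ∈ G 0)
    (one' : (1 : A) ∉ G 1) : Quasivaluation k A := by
  classical
  let val : A → WithTop ℤ := fun f =>
    if h : ∃ r, IsGreatest {r : ℤ | f ∈ G r} r then ((Classical.choose h : ℤ) : WithTop ℤ) else ⊤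
  have key : ∀ (f : A) (s : ℤ), (s : WithTop ℤ) ≤ val f ↔ f ∈ G s := by
    intro f s
    by_cases h : ∃ r, IsGreatest {r : ℤ | f ∈ G r} r
    · have hr := Classical.choose_spec h
      simp only [val, dif_pos h, WithTop.coe_le_coe]
      exact ⟨fun hs => anti hs hr.1, fun hs => hr.2 hs⟩
    · simp only [val, dif_neg h, le_top, true_iff]
      by_contra hs
      apply h
      obtain ⟨r, hr⟩ := exh f
      have hb : ∀ z : ℤ, f ∈ G z → z ≤ s := fun z hz => by
        by_contra hlt
        exact hs (anti (not_le.mp hlt).le hz)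
      obtain ⟨ub, h1, h2⟩ := Int.exists_greatest_of_bdd (P := fun z => f ∈ G z) ⟨s, hb⟩ ⟨r, hr⟩
      exact ⟨ub, h1, fun z hz => h2 z hz⟩
  exact
    { val := val
      val_mul := fun f g => by
        refine le_of_forall_int_le fun s hs => (key _ _).2 ?_
        have main : ∀ p q : ℤ, (p : WithTop ℤ) ≤ val f → (q : WithTop ℤ) ≤ val g → s ≤ p + q →
            f * g ∈ G s := fun p q hp hq hpq =>
          anti hpq (mul p q f g ((key _ _).1 hp) ((key _ _).1 hq))
        cases hf : val f with
        | top =>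
          cases hg : val g with
          | top => exact main s 0 (hf ▸ le_top) (hg ▸ le_top) (by omega)
          | coe q => exact main (s - q) q (hf ▸ le_top) hg.ge (by omega)
        | coe p =>
          cases hg : val g with
          | top => exact main p (s - p) hf.ge (hg ▸ le_top) (by omega)
          | coe q =>
            rw [hf, hg] at hs
            exact main p q hf.ge hg.ge (by exact_mod_cast hs)
      val_add := fun f g => by
        refine le_of_forall_int_le fun s hs => (key _ _).2 ?_
        obtain ⟨h1, h2⟩ := le_min_iff.1 hs
        exact (G s).add_mem ((key _ _).1 h1) ((key _ _).1 h2)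
      val_const := fun c hc => by
        apply le_antisymm
        · refine le_of_forall_int_le fun s hs => ?_
          have h1 := (G s).smul_mem c⁻¹ ((key _ _).1 hs)
          rw [Algebra.algebraMap_eq_smul_one, smul_smul, inv_mul_cancel₀ hc, one_smul] at h1
          by_contra hs'
          have : 1 ≤ s := by
            by_contra h
            exact hs' (by exact_mod_cast (by omega : s ≤ 0))
          exact one' (anti this h1)
        · have := (key (algebraMap k A c) 0).2 (by
            rw [Algebra.algebraMap_eq_smul_one]; exact (G 0).smul_mem c one)
          simpa using this
      val_zero := by
        have h : ∀ s : ℤ, (s : WithTop ℤ) ≤ val 0 := fun s => (key 0 s).2 (G s).zero_mem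
        exact top_le_iff.1 (le_of_forall_int_le fun s _ => h s) }

/-! ### Associated graded algebra -/

/-- The Rees algebra `⨁ᵣ G_r · tʳ ⊆ A[t, t⁻¹]` of a quasivaluation. -/
def rees (v : Quasivaluation k A) : Subalgebra k (AddMonoidAlgebra A ℤ) :=
  gradedSubalgebra v.level v.one_mem_level fun _ _ _ _ hf hg => v.mul_mem_level hf hg

/-- The ideal `⨁ᵣ G_{>r} · tʳ` of the Rees algebra. -/
def reesPos (v : Quasivaluation k A) : Ideal v.rees where
  carrier := {f | ∀ r : ℤ, f.1.coeff r ∈ v.level (r + 1)}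
  add_mem' := fun {f g} hf hg r => (v.level (r + 1)).add_mem (hf r) (hg r)
  zero_mem' := fun r => (v.level (r + 1)).zero_mem
  smul_mem' := fun c f hf r => by
    classical
    change (c.1 * f.1).coeff r ∈ _
    rw [AddMonoidAlgebra.coeff_mul]
    refine (v.level (r + 1)).sum_mem fun a _ => (v.level (r + 1)).sum_mem fun b _ => ?_
    dsimp only
    split_ifs with h
    · have := v.mul_mem_level (c.2 a) (hf b)
      rwa [← add_assoc, h] at this
    · exact (v.level (r + 1)).zero_mem

/-- The associated graded algebra `gr_v(A) = ⨁ᵣ G_r / G_{>r}`. -/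
abbrev Gr (v : Quasivaluation k A) : Type _ := v.rees ⧸ v.reesPos

/-- The class of `f · tʳ` in `gr_v(A)`, for `f ∈ G_r`. -/
def toGr (v : Quasivaluation k A) (r : ℤ) (f : A) (hf : f ∈ v.level r) : v.Gr :=
  Ideal.Quotient.mk v.reesPos ⟨AddMonoidAlgebra.single r f, fun s => by
    classical
    rw [AddMonoidAlgebra.coeff_single, Finsupp.single_apply]
    split_ifs with h
    · exact h ▸ hf
    · exact (v.level s).zero_mem⟩

/-- The initial form `f̄ ∈ gr_v(A)`: the class of `f` in `G_{v(f)} / G_{>v(f)}`, and `0` if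
`v f = ∞`. -/
def init (v : Quasivaluation k A) (f : A) : v.Gr :=
  if h : v.val f = ⊤ then 0
  else v.toGr ((v.val f).untop h) f (by rw [mem_level, WithTop.coe_untop])

/-- The ideal `J_B` of polynomial relations among the initial forms of the elements of `B`. -/
def initRelations (v : Quasivaluation k A) (B : Finset A) : Ideal (MvPolynomial B k) :=
  RingHom.ker (MvPolynomial.aeval (R := k) fun b : B => v.init b.1)

/-- The extension of a quasivaluation of `A` to the ring `A[t^Γ]`:
`v(∑ aᵣ tʳ) = minᵣ v(aᵣ)`. -/
def laurent (v : Quasivaluation k A) (Γ : Type*) [AddCommMonoid Γ] :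
    Quasivaluation k (AddMonoidAlgebra A Γ) where
  val := fun f => f.coeff.support.inf fun r => v.val (f.coeff r)
  val_mul := fun f g => by
    classical
    have key : ∀ (h : AddMonoidAlgebra A Γ) r,
        (h.coeff.support.inf fun r => v.val (h.coeff r)) ≤ v.val (h.coeff r) := fun h r => by
      by_cases hr : r ∈ h.coeff.support
      · exact Finset.inf_le hr
      · rw [Finsupp.notMem_support_iff.1 hr, v.val_zero]; exact le_top
    refine Finset.le_inf fun r _ => le_of_forall_int_le fun s hs => ?_
    rw [← v.mem_level, AddMonoidAlgebra.coeff_mul]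
    refine (v.level s).sum_mem fun a _ => (v.level s).sum_mem fun b _ => ?_
    dsimp only
    split_ifs with h
    · exact hs.trans ((add_le_add (key f a) (key g b)).trans (v.val_mul _ _))
    · exact (v.level s).zero_mem
  val_add := fun f g => by
    classical
    have key : ∀ (h : AddMonoidAlgebra A Γ) r,
        (h.coeff.support.inf fun r => v.val (h.coeff r)) ≤ v.val (h.coeff r) := fun h r => by
      by_cases hr : r ∈ h.coeff.support
      · exact Finset.inf_le hr
      · rw [Finsupp.notMem_support_iff.1 hr, v.val_zero]; exact le_top
    refine Finset.le_inf fun r _ => ?_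
    rw [AddMonoidAlgebra.coeff_add, Finsupp.add_apply]
    exact (min_le_min (key f r) (key g r)).trans (v.val_add _ _)
  val_const := fun c hc => by
    classical
    have h : algebraMap k (AddMonoidAlgebra A Γ) c = AddMonoidAlgebra.single 0 (algebraMap k A c) :=
      rfl
    have h0 : algebraMap k A c ≠ 0 := fun h0 => by
      have := v.val_const c hc
      rw [h0, v.val_zero] at this
      exact WithTop.top_ne_zero this
    rw [h, AddMonoidAlgebra.coeff_single, Finsupp.support_single _ h0]
    simp [v.val_const c hc]
  val_zero := by simp

end Quasivaluation

/-! ### Smooth fans -/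

/-- A finite smooth fan in the lattice `N`. Every cone is recorded by the set of primitive
generators of its rays; since the cone is smooth, its lattice points are the
`ℕ`-combinations of these generators, and its faces correspond to the subsets. -/
structure SmoothFan (N : Type*) [AddCommGroup N] where
  /-- the generating sets of the cones -/
  cones : Finset (Finset N)
  zero_cone : ∅ ∈ cones
  face : ∀ s ∈ cones, ∀ t ⊆ s, t ∈ cones
  smooth : ∀ s ∈ cones, ∃ b : Module.Basis (Fin (Module.finrank ℤ N)) ℤ N,
    (s : Set N) ⊆ Set.range b
  inter : ∀ s ∈ cones, ∀ t ∈ cones,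
    AddSubmonoid.closure (s : Set N) ⊓ AddSubmonoid.closure (t : Set N) =
      AddSubmonoid.closure ((s : Set N) ∩ (t : Set N))

namespace SmoothFan

variable {N : Type*} [AddCommGroup N] (F : SmoothFan N)

/-- The lattice points of the support `|Σ|`. -/
def Point : Type _ :=
  {x : N // ∃ s ∈ F.cones, x ∈ AddSubmonoid.closure (s : Set N)}

/-- The rays `Σ(1)`, given by their primitive generators. -/
def Ray : Type _ := {x : N // ({x} : Finset N) ∈ F.cones}

/-- The primitive generator of a ray, as a point of the support. -/
def Ray.point {F : SmoothFan N} (r : F.Ray) : F.Point :=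
  ⟨r.1, {r.1}, r.2, AddSubmonoid.subset_closure (by simp)⟩

/-- The group of integral piecewise linear functions on `Σ`, i.e. of functions on the lattice
points of `|Σ|` that are linear on every cone (the linearized line bundles). -/
def PL : AddSubgroup (F.Point → ℤ) where
  carrier := {ψ | ∀ s ∈ F.cones, ∃ m : N →ₗ[ℤ] ℤ,
    ∀ x : F.Point, x.1 ∈ AddSubmonoid.closure (s : Set N) → ψ x = m x.1}
  add_mem' := fun {a b} ha hb s hs => by
    obtain ⟨m, hm⟩ := ha s hs
    obtain ⟨m', hm'⟩ := hb s hs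
    exact ⟨m + m', fun x hx => by simp [hm x hx, hm' x hx]⟩
  zero_mem' := fun s _ => ⟨0, fun x _ => by simp⟩
  neg_mem' := fun {a} ha s hs => by
    obtain ⟨m, hm⟩ := ha s hs
    exact ⟨-m, fun x hx => by simp [hm x hx]⟩

section

variable {k A E : Type*} [Field k] [CommRing A] [Algebra k A]

/-- A linear adapted basis of a prevalued space on the cone generated by `s`: a basis `b` such that
`(E, v)` is on this cone the direct sum of the `(k · b i, m i)`, with `m i` linear. -/
def HasLinearAdaptedBasis {E : Type u} [AddCommGroup E] [Module k E]
    (v : F.Point → Prevaluation k E) (s : Finset N) : Prop :=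
  ∃ (κ : Type u) (b : Module.Basis κ k E) (m : κ → N →ₗ[ℤ] ℤ),
    ∀ x : F.Point, x.1 ∈ AddSubmonoid.closure (s : Set N) → ∀ f : E,
      (v x).val f = (b.repr f).support.inf fun i => ((m i x.1 : ℤ) : WithTop ℤ)

/-- A flat toric sheaf of graded algebras over the toric variety of `Σ`, with general fiber the
graded algebra `A`: a quasivaluation `v` of `A` into functions on `|Σ|` that is homogeneous for the
grading and has a linear adapted basis on every cone. -/
structure IsFlatToric (𝒜 : ℕ → Submodule k A) [GradedAlgebra 𝒜]
    (v : F.Point → Quasivaluation k A) : Prop where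
  /-- `v x f` is the minimum of the values of the homogeneous components of `f`; the other
  inequality is automatic -/
  homogeneous : ∀ x f (d : ℕ), (v x).val f ≤ (v x).val (DirectSum.decompose 𝒜 f d : A)
  adapted : ∀ s ∈ F.cones, F.HasLinearAdaptedBasis (fun x => (v x).toPrevaluation) s

/-- The Klyachko space `F_ψ(v) = {f ∣ v(f) ≥ ψ}`. -/
def sections (v : F.Point → Quasivaluation k A) (ψ : F.PL) : Submodule k A :=
  ⨅ x : F.Point, (v x).level (ψ.1 x)

/-- The total section ring `R(A, v̂) = ⨁_ψ F_ψ(v)`, over all piecewise linear `ψ`, as a subalgebra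
of `A[t^ψ ∣ ψ]`. -/
def totalSections (v : F.Point → Quasivaluation k A) : Subalgebra k (AddMonoidAlgebra A F.PL) :=
  gradedSubalgebra (F.sections v)
    (by
      rw [sections, Submodule.mem_iInf]
      exact fun x => (v x).one_mem_level)
    (fun r s f g hf hg => by
      rw [sections, Submodule.mem_iInf] at *
      exact fun x => (v x).mul_mem_level (hf x) (hg x))

/-- The map `∑ a_ψ t^ψ ↦ ∑ a_ψ` onto the general fiber. -/
def toFiber (f : AddMonoidAlgebra A F.PL) : A := f.coeff.sum fun _ a => a

/-- `B ⊆ A` is a strong Khovanskii basis: it is the image of a set of homogeneous generators of the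
total section ring. -/
def IsStrongKhovanskiiBasis (v : F.Point → Quasivaluation k A) (B : Set A) : Prop :=
  ∃ S : Set (AddMonoidAlgebra A F.PL),
    (∀ f ∈ S, ∃ (ψ : F.PL) (a : A), f = AddMonoidAlgebra.single ψ a) ∧
    Algebra.adjoin k S = F.totalSections v ∧ B = F.toFiber '' S

end

end SmoothFan

/-! ### Toric vector bundles -/

section Bundles

variable {k : Type*} [Field k] {N : Type*} [AddCommGroup N]

/-- A toric vector bundle with general fiber `E` over the toric variety of `Σ`, in terms of its
prevaluation: a prevaluation of the finite-dimensional space `E` into functions on `|Σ|`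
which has a linear adapted basis on every cone. -/
structure ToricBundle (F : SmoothFan N) (k : Type*) [Field k] (E : Type u) [AddCommGroup E]
    [Module k E] where
  /-- the prevaluation at a lattice point of the support -/
  preval : F.Point → Prevaluation k E
  finite : FiniteDimensional k E
  adapted : ∀ s ∈ F.cones, F.HasLinearAdaptedBasis preval s

variable {E : Type*} [AddCommGroup E] [Module k E]

/-- The filtration of `Sym(E)` induced by a prevaluation of `E`: step `r` is spanned by the products
`e₁ ⋯ eₘ` with `v(e₁) + ⋯ + v(eₘ) ≥ r`. -/
def symFiltration (v : Prevaluation k E) (r : ℤ) : Submodule k (SymmetricAlgebra k E) :=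
  Submodule.span k {f | ∃ l : List E, f = (l.map (SymmetricAlgebra.ι k E)).prod ∧
    (r : WithTop ℤ) ≤ (l.map v.val).sum}

lemma symFiltration_anti (v : Prevaluation k E) : Antitone (symFiltration v) := by
  intro r s h
  refine Submodule.span_mono ?_
  rintro f ⟨l, rfl, hl⟩
  exact ⟨l, rfl, le_trans (by exact_mod_cast h) hl⟩

lemma symFiltration_mul (v : Prevaluation k E) (r s : ℤ) (f g : SymmetricAlgebra k E)
    (hf : f ∈ symFiltration v r) (hg : g ∈ symFiltration v s) :
    f * g ∈ symFiltration v (r + s) := by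
  have h := Submodule.mul_mem_mul hf hg
  rw [symFiltration, symFiltration, Submodule.span_mul_span] at h
  refine Submodule.span_mono ?_ h
  rintro _ ⟨_, ⟨l, rfl, hl⟩, _, ⟨l', rfl, hl'⟩, rfl⟩
  refine ⟨l ++ l', by simp, ?_⟩
  rw [List.map_append, List.sum_append]
  push_cast
  exact add_le_add hl hl'

lemma symFiltration_one (v : Prevaluation k E) :
    (1 : SymmetricAlgebra k E) ∈ symFiltration v 0 :=
  Submodule.subset_span ⟨[], by simp, by simp⟩

lemma symFiltration_one' (v : Prevaluation k E) :
    (1 : SymmetricAlgebra k E) ∉ symFiltration v 1 := by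
  intro h
  have : ∀ f ∈ symFiltration v 1, (SymmetricAlgebra.algebraMapInv : _ →ₐ[k] k) f = 0 := by
    intro f hf
    induction hf using Submodule.span_induction with
    | mem x hx =>
      obtain ⟨l, rfl, hl⟩ := hx
      cases l with
      | nil =>
        exfalso
        rw [List.map_nil, List.sum_nil] at hl
        have h2 : (1 : ℤ) ≤ 0 := by exact_mod_cast hl
        omega
      | cons e l => simp [SymmetricAlgebra.algebraMapInv_ι]
    | zero => simp
    | add x y _ _ hx hy => simp [hx, hy]
    | smul c x _ hx => simp [hx]
  simpa using this 1 h

lemma symFiltration_exh (v : Prevaluation k E) (f : SymmetricAlgebra k E) :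
    ∃ r, f ∈ symFiltration v r := by
  induction f using SymmetricAlgebra.induction with
  | algebraMap c =>
    refine ⟨0, ?_⟩
    rw [Algebra.algebraMap_eq_smul_one]
    exact (symFiltration v 0).smul_mem c (symFiltration_one v)
  | ι e =>
    cases h : v.val e with
    | top => exact ⟨0, Submodule.subset_span ⟨[e], by simp, by simp [h]⟩⟩
    | coe r => exact ⟨r, Submodule.subset_span ⟨[e], by simp, by simp [h]⟩⟩
  | mul f g hf hg =>
    obtain ⟨r, hr⟩ := hf
    obtain ⟨s, hs⟩ := hg
    exact ⟨r + s, symFiltration_mul v r s f g hr hs⟩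
  | add f g hf hg =>
    obtain ⟨r, hr⟩ := hf
    obtain ⟨s, hs⟩ := hg
    exact ⟨min r s, (symFiltration v _).add_mem (symFiltration_anti v (min_le_left r s) hr)
      (symFiltration_anti v (min_le_right r s) hs)⟩

/-- The quasivaluation `s(v)` of `Sym(E)` induced by a prevaluation `v` of `E`. -/
def symVal (v : Prevaluation k E) : Quasivaluation k (SymmetricAlgebra k E) :=
  Quasivaluation.ofFiltration (symFiltration v) (symFiltration_anti v) (symFiltration_exh v)
    (symFiltration_mul v) (symFiltration_one v) (symFiltration_one' v)

/-- The grading of `Sym(E)`: `Symᵈ(E)` is spanned by the `d`-fold products of elements of `E`. -/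
def symGrading (k E : Type*) [Field k] [AddCommGroup E] [Module k E] (d : ℕ) :
    Submodule k (SymmetricAlgebra k E) :=
  LinearMap.range (SymmetricAlgebra.ι k E) ^ d

/-- The quasivaluation of `Sym(E)` attached to a toric vector bundle. -/
def ToricBundle.val {F : SmoothFan N} {E : Type u} [AddCommGroup E] [Module k E]
    (𝓔 : ToricBundle F k E) (x : F.Point) : Quasivaluation k (SymmetricAlgebra k E) :=
  symVal (𝓔.preval x)

/-- The Cox ring `R(𝓔) = ⨁_ψ F_ψ(Sym E)` of (the projectivization of) a toric vector bundle. -/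
def ToricBundle.coxRing {F : SmoothFan N} {E : Type u} [AddCommGroup E] [Module k E]
    (𝓔 : ToricBundle F k E) :
    Subalgebra k (AddMonoidAlgebra (SymmetricAlgebra k E) F.PL) :=
  F.totalSections 𝓔.val

end Bundles

/-! ### The algorithm -/

section Algorithm

variable {k A : Type*} [Field k] [CommRing A] [Algebra k A]

/-- The ring `A ⊗ T_n = A[t₁^±, …, tₙ^±]`. -/
abbrev Laurent (A : Type*) [CommRing A] (n : ℕ) : Type _ := AddMonoidAlgebra A (Fin n → ℤ)

variable {n : ℕ}

/-- The extension of `w j` to `A ⊗ T_n`. -/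
abbrev extVal (w : Fin n → Quasivaluation k A) (j : Fin n) : Quasivaluation k (Laurent A n) :=
  (w j).laurent (Fin n → ℤ)

/-- The partial multi-Rees algebra `R_j = ⨁_{r ∈ ℤʲ} ⋂_{i ≤ j} G_{r_i}(w_i)`, as a subalgebra of
`A ⊗ T_j ⊆ A ⊗ T_n`. -/
def partialRees (w : Fin n → Quasivaluation k A) (j : ℕ) : Subalgebra k (Laurent A n) :=
  gradedSubalgebra
    (fun r : Fin n → ℤ =>
      { carrier := {a | (∀ i : Fin n, i.1 < j → a ∈ (w i).level (r i)) ∧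
          ((∃ i : Fin n, j ≤ i.1 ∧ r i ≠ 0) → a = 0)}
        add_mem' := fun {a b} ha hb =>
          ⟨fun i hi => ((w i).level (r i)).add_mem (ha.1 i hi) (hb.1 i hi),
            fun h => by rw [ha.2 h, hb.2 h, add_zero]⟩
        zero_mem' := ⟨fun i _ => ((w i).level (r i)).zero_mem, fun _ => rfl⟩
        smul_mem' := fun c a ha =>
          ⟨fun i hi => ((w i).level (r i)).smul_mem c (ha.1 i hi),
            fun h => by rw [ha.2 h, smul_zero]⟩ })
    ⟨fun i _ => (w i).one_mem_level, fun ⟨i, _, h⟩ => absurd rfl h⟩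
    (fun r s a b ha hb => ⟨fun i hi => (w i).mul_mem_level (ha.1 i hi) (hb.1 i hi), by
      rintro ⟨i, hi, h⟩
      by_cases hr : r i = 0
      · have hs : s i ≠ 0 := fun hs => h (by simp [hr, hs])
        rw [hb.2 ⟨i, hi, hs⟩, mul_zero]
      · rw [ha.2 ⟨i, hi, hr⟩, zero_mul]⟩)

/-- The graded component of `A ⊗ T_n` of degree `d ∈ ℕ` in `A` and degree `r ∈ ℤⁿ` in the `t_i`. -/
def component (𝒜 : ℕ → Submodule k A) (d : ℕ) (r : Fin n → ℤ) : Set (Laurent A n) :=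
  {f | ∃ a ∈ 𝒜 d, f = AddMonoidAlgebra.single r a}

/-- Substitution of the elements of `B` for the variables. -/
def evalAt {R : Type*} [CommRing R] [Algebra k R] (B : Finset R) : MvPolynomial B k →ₐ[k] R :=
  MvPolynomial.aeval fun b : B => b.1

/-- A polynomial in the elements of `B` is homogeneous of degree `(d, r)`: this is the degree of the
value of each of its monomials. -/
def IsMultihomogeneous (𝒜 : ℕ → Submodule k A) (d : ℕ) (r : Fin n → ℤ)
    {B : Finset (Laurent A n)} (p : MvPolynomial B k) : Prop :=
  ∀ m ∈ p.support, evalAt (k := k) B (MvPolynomial.monomial m 1) ∈ component 𝒜 d r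

/-- A polynomial in the elements of `B` is homogeneous of weight `s`, where the variable of `b` has
weight `v b`. -/
def IsOfWeight {R : Type*} [CommRing R] [Algebra k R] (v : Quasivaluation k R)
    {B : Finset R} (p : MvPolynomial B k) (s : WithTop ℤ) : Prop :=
  MvPolynomial.IsWeightedHomogeneous (fun b : B => v.val b.1) p s

/-- The states of the algorithm. -/
inductive State (A : Type*) [CommRing A] (n : ℕ) : Type _
  /-- the generating set is `B`; the first `j` rays have been dealt with -/
  | stage (j : ℕ) (B : Finset (Laurent A n))
  /-- a pass of the inner loop, for the ray number `j`, that started with the generating set `B₀`;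
  the current generating set is `B`, and the elements of `todo` have to be examined -/
  | pass (j : Fin n) (B₀ B : Finset (Laurent A n)) (todo : List (Laurent A n))

open Classical in
/-- The Rees lift: `{b · t_j^{v_j(b)} ∣ b ∈ B} ∪ {t_j⁻¹}`. -/
def reesLift (w : Fin n → Quasivaluation k A) (j : Fin n) (B : Finset (Laurent A n)) :
    Finset (Laurent A n) :=
  insert (AddMonoidAlgebra.single (Pi.single j (-1)) 1)
    (B.image fun b =>
      b * AddMonoidAlgebra.single (Pi.single j (((extVal w j).val b).untopD 0)) 1)

open Classical in
/-- The single steps of the iterated Khovanskii basis completion algorithm. All choices (of the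
generators of the ideal of relations, and of the polynomials in a subduction) are free, but are made
homogeneously. -/
inductive Step (𝒜 : ℕ → Submodule k A) (w : Fin n → Quasivaluation k A) :
    State A n → State A n → Prop
  /-- Begin a pass: choose homogeneous generators `g` of the ideal of relations among the initial
  forms of the elements of `B`, and compute the values `g(B)`. -/
  | start (j : Fin n) (B : Finset (Laurent A n)) (G : List (MvPolynomial B k))
      (homog : ∀ g ∈ G, (∃ s, IsOfWeight (extVal w j) g s) ∧ ∃ d r, IsMultihomogeneous 𝒜 d r g)
      (gen : Ideal.span {g | g ∈ G} = (extVal w j).initRelations B) :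
      Step 𝒜 w (.stage j B) (.pass j B B (G.map (evalAt B)))
  /-- Nothing to do for the element `0`. -/
  | skip (j : Fin n) (B₀ B : Finset (Laurent A n)) (todo : List (Laurent A n)) :
      Step 𝒜 w (.pass j B₀ B (0 :: todo)) (.pass j B₀ B todo)
  /-- If the initial form of `h` is a polynomial `p` in the initial forms of the elements of `B`,
  then replace `h` by `h - p(B)`. -/
  | subduct (j : Fin n) (B₀ B : Finset (Laurent A n)) (h : Laurent A n) (todo : List (Laurent A n))
      (ne : h ≠ 0) (p : MvPolynomial B k) (d : ℕ) (r : Fin n → ℤ)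
      (weight : IsOfWeight (extVal w j) p ((extVal w j).val h))
      (homog : IsMultihomogeneous 𝒜 d r p) (deg : h ∈ component 𝒜 d r)
      (eq : (extVal w j).init h = MvPolynomial.aeval (fun b : B => (extVal w j).init b.1) p) :
      Step 𝒜 w (.pass j B₀ B (h :: todo)) (.pass j B₀ B ((h - evalAt B p) :: todo))
  /-- If the initial form of `h` is not a polynomial in the initial forms of the elements of `B`,
  then add `h` to `B`. -/
  | adjoin (j : Fin n) (B₀ B : Finset (Laurent A n)) (h : Laurent A n) (todo : List (Laurent A n))
      (new : (extVal w j).init h ∉ Algebra.adjoin k ((extVal w j).init '' (B : Set (Laurent A n)))) :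
      Step 𝒜 w (.pass j B₀ B (h :: todo)) (.pass j B₀ (insert h B) todo)
  /-- If the generating set has changed during the pass, then begin a new pass. -/
  | again (j : Fin n) (B₀ B : Finset (Laurent A n)) (changed : B ≠ B₀) :
      Step 𝒜 w (.pass j B₀ B []) (.stage j B)
  /-- If it has not changed, then it is a Khovanskii basis; pass to the Rees algebra and to the next
  ray. -/
  | advance (j : Fin n) (B : Finset (Laurent A n)) :
      Step 𝒜 w (.pass j B B []) (.stage (j + 1) (reesLift w j B))

open Classical in
/-- The initial state, for a finite set of generators of `A`. -/
def initialState (n : ℕ) (B : Finset A) : State A n :=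
  .stage 0 (B.image (AddMonoidAlgebra.single 0))

/-- Every run of the algorithm from the given state is finite and ends with an output, i.e. all
`n` rays have been dealt with. -/
inductive Terminates (𝒜 : ℕ → Submodule k A) (w : Fin n → Quasivaluation k A) : State A n → Prop
  | output (B : Finset (Laurent A n)) : Terminates 𝒜 w (.stage n B)
  | step (S : State A n) (progress : ∃ S', Step 𝒜 w S S')
      (all : ∀ S', Step 𝒜 w S S' → Terminates 𝒜 w S') : Terminates 𝒜 w S

/-- Some run of the algorithm from the given state ends with an output. -/
def CanTerminate (𝒜 : ℕ → Submodule k A) (w : Fin n → Quasivaluation k A) (S : State A n) : Prop :=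
  ∃ B, Relation.ReflTransGen (Step 𝒜 w) S (.stage n B)

/-- A finite set of homogeneous generators of a graded algebra. -/
def IsHomogeneousGenerators (𝒜 : ℕ → Submodule k A) (B : Finset A) : Prop :=
  (∀ b ∈ B, ∃ d, b ∈ 𝒜 d) ∧ Algebra.adjoin k (B : Set A) = ⊤

end Algorithm

end StrongKhovanskii

end

open StrongKhovanskii

namespace StrongKhovanskii

noncomputable section

open MvPolynomial

/-! For a finite set `B` of generators of `R_j`, let `W_s` be the span of the monomials in `B` of
weight at least `s`, where `b` has weight `v(b)` (`weightFiltration`). Always `W_s ⊆ G_s`.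
Everything turns on completeness (`IsComplete`): `R_j ∩ G_s ⊆ W_s` for all `s`. If `B` is complete,
the elements `b t^{v(b)}` and `t⁻¹` generate the Rees algebra `R_{j+1}`
(`IsStageGenerators.reesLift`).

A polynomial of finite weight `s` is a relation among the initial forms exactly when its value at
`B` lies in `G_{s+1}`. A finished pass from `B₀` to `B` rewrites the values of generators of the
ideal of relations, hence of all relations, in higher weight: `W_s(B₀) ∩ G_{s+1} ⊆ W_{s+1}(B)`. If
`B = B₀`, an element of `R_j`, which lies in some `W_r` because `B` generates, climbs to any level
containing it in finitely many steps, so `B` is complete. Conversely, a pass adds nothing to a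
complete set. Hence a run that ends yields finitely many homogeneous generators of `R_n`.

For the converse let `R_n` be finitely generated. Then so is every `R_j`, the image of `R_n` under
`t_i ↦ 1` for the later variables (`partialRees_fg`). A single pass is finite: subduction keeps `h`
in one component, a copy of the finite-dimensional space `A_d`, and strictly raises its value, while
only `0` has infinite value (`terminates_pass`). Infinitely many passes would give increasing sets
whose weight filtrations exhaust the `R_j ∩ G_s`; the finitely many generators of `R_{j+1}` are then
accounted for by one of these sets, which is complete and cannot be enlarged
(`exists_isComplete_of_seq`, `terminates_stage`).

On the toric side, smoothness identifies piecewise linear functions with their values on the rays,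
and adapted bases reduce `v(f) ≥ ψ` to the rays, so the total section ring is isomorphic to `R_n`
(`SmoothFan.map_totalSections`). A finite strong Khovanskii basis amounts to finite generation of
`R_n`, since lowering exponents only costs the elements `t_i⁻¹`. For a bundle, the monomials in an
adapted basis of `E` form an adapted basis of `Sym(E)`, so the same argument applies. -/

lemma finsupp_nat_induction {σ : Type*} {P : (σ →₀ ℕ) → Prop} (m : σ →₀ ℕ) (zero : P 0)
    (add : ∀ m m', P m → P m' → P (m + m')) (single : ∀ i, P (Finsupp.single i 1)) : P m := by
  induction m using Finsupp.induction_linear with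
  | zero => exact zero
  | add m m' h h' => exact add m m' h h'
  | single i e =>
    induction e with
    | zero => simpa using zero
    | succ e ih => rw [Finsupp.single_add]; exact add _ _ ih (single i)

/-! ### Subduction -/

section Subduction

variable {k R : Type*} [Field k] [CommRing R] [Algebra k R]

lemma mem_gradedSubalgebra {Γ : Type*} [AddCommMonoid Γ] {P : Γ → Submodule k R}
    {one_mem : (1 : R) ∈ P 0} {mul_mem : ∀ r s a b, a ∈ P r → b ∈ P s → a * b ∈ P (r + s)}
    {f : AddMonoidAlgebra R Γ} :
    f ∈ gradedSubalgebra P one_mem mul_mem ↔ ∀ r, f.coeff r ∈ P r := Iff.rfl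

lemma single_mem_gradedSubalgebra {Γ : Type*} [AddCommMonoid Γ] {P : Γ → Submodule k R}
    {one_mem : (1 : R) ∈ P 0} {mul_mem : ∀ r s a b, a ∈ P r → b ∈ P s → a * b ∈ P (r + s)}
    {r : Γ} {a : R} :
    AddMonoidAlgebra.single r a ∈ gradedSubalgebra P one_mem mul_mem ↔ a ∈ P r := by
  classical
  rw [mem_gradedSubalgebra]
  refine ⟨fun h => by simpa using h r, fun h s => ?_⟩
  rw [AddMonoidAlgebra.coeff_single, Finsupp.single_apply]
  split_ifs with hs
  · exact hs ▸ h
  · exact (P s).zero_mem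

variable (v : Quasivaluation k R)

lemma Quasivaluation.level_anti : Antitone v.level := fun _ _ h _ hf =>
  le_trans (WithTop.coe_le_coe.2 h) hf

lemma Quasivaluation.toGr_mul {r s : ℤ} {f g : R} (hf : f ∈ v.level r) (hg : g ∈ v.level s) :
    v.toGr r f hf * v.toGr s g hg = v.toGr (r + s) (f * g) (v.mul_mem_level hf hg) := by
  rw [toGr, toGr, ← map_mul, toGr]
  congr 1
  exact Subtype.ext (AddMonoidAlgebra.single_mul_single ..)

lemma Quasivaluation.toGr_congr {r s : ℤ} {f g : R} (hf : f ∈ v.level r) (hg : g ∈ v.level s)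
    (h : r = s) (h' : f = g) : v.toGr r f hf = v.toGr s g hg := by
  subst h h'; rfl

lemma Quasivaluation.init_eq_toGr {f : R} {s : ℤ} (h : v.val f = s) :
    v.init f = v.toGr s f h.ge := by
  rw [init, dif_neg (by simp [h])]
  exact v.toGr_congr _ _ (by simp [h]) rfl

lemma Quasivaluation.init_eq_zero {f : R} (h : v.val f = ⊤) : v.init f = 0 := by
  rw [init, dif_pos h]

variable {v} {B : Finset R}

/-- Only an inequality, since `v` is merely supermultiplicative; the algorithm exists to close this
gap between weight and value. -/
lemma weight_le_val (m : B →₀ ℕ) :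
    Finsupp.weight (fun b : B => v.val b.1) m ≤ v.val (evalAt (k := k) B (monomial m 1)) := by
  induction m using finsupp_nat_induction with
  | zero =>
    rw [map_zero, show (monomial (0 : B →₀ ℕ) (1 : k)) = 1 from rfl, map_one, v.val_one]
  | add m m' h h' =>
    rw [map_add, ← one_mul (1 : k), ← monomial_mul, map_mul]
    exact (add_le_add h h').trans (v.val_mul _ _)
  | single b =>
    rw [Finsupp.weight_single, one_smul]
    simp [evalAt, ← X.eq_1]

lemma evalAt_monomial_mem_level {m : B →₀ ℕ} {s : ℤ} {c : k}
    (h : (s : WithTop ℤ) ≤ Finsupp.weight (fun b : B => v.val b.1) m) :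
    evalAt B (monomial m c) ∈ v.level s := by
  rw [← mul_one c, ← smul_eq_mul, ← smul_monomial, map_smul]
  exact (v.level s).smul_mem c (h.trans (weight_le_val m))

lemma aeval_init_monomial_eq_zero (m : B →₀ ℕ)
    (h : Finsupp.weight (fun b : B => v.val b.1) m = ⊤) :
    aeval (R := k) (fun b : B => v.init b.1) (monomial m 1) = 0 := by
  induction m using finsupp_nat_induction with
  | zero => simp at h
  | add m m' h1 h2 =>
    rw [map_add, WithTop.add_eq_top] at h
    rw [← one_mul (1 : k), ← monomial_mul, map_mul]
    rcases h with h | h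
    · rw [h1 h, zero_mul]
    · rw [h2 h, mul_zero]
  | single b =>
    rw [Finsupp.weight_single, one_smul] at h
    simpa [← X.eq_1] using v.init_eq_zero h

/-- The class is taken in the degree given by the weight, not by the value of `f`. It vanishes when
the value exceeds the weight, and for this reason it is multiplicative. -/
lemma aeval_init_monomial (m : B →₀ ℕ) {s : ℤ} {f : R} (hf : f ∈ v.level s)
    (h : Finsupp.weight (fun b : B => v.val b.1) m = s) (he : evalAt B (monomial m (1 : k)) = f) :
    aeval (R := k) (fun b : B => v.init b.1) (monomial m 1) = v.toGr s f hf := by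
  induction m using finsupp_nat_induction generalizing s f with
  | zero =>
    have hs : s = 0 := by rw [map_zero] at h; exact_mod_cast h.symm
    subst hs
    rw [show (monomial (0 : B →₀ ℕ) (1 : k)) = 1 from rfl, map_one] at he ⊢
    subst he
    rfl
  | add m m' h1 h2 =>
    rw [map_add] at h
    obtain ⟨r, r', hr, hr', rfl⟩ := WithTop.add_eq_coe.1 h
    rw [← one_mul (1 : k), ← monomial_mul, map_mul] at he ⊢
    rw [h1 (evalAt_monomial_mem_level hr.le) hr.symm rfl,
      h2 (evalAt_monomial_mem_level hr'.le) hr'.symm rfl, Quasivaluation.toGr_mul]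
    exact v.toGr_congr _ _ rfl he
  | single b =>
    rw [Finsupp.weight_single, one_smul] at h
    have e : b.1 = f := by simpa [evalAt, ← X.eq_1] using he
    subst e
    simpa [← X.eq_1] using v.init_eq_toGr h

/-- The value of a polynomial in the initial forms is represented by the values of its weighted
homogeneous components. -/
lemma exists_rees_eq_aeval_init (v : Quasivaluation k R) (p : MvPolynomial B k) :
    ∃ P : v.rees, Ideal.Quotient.mk v.reesPos P = aeval (fun b : B => v.init b.1) p ∧
      ∀ s : ℤ, P.1.coeff s =
        evalAt B (weightedHomogeneousComponent (fun b : B => v.val b.1) (s : WithTop ℤ) p) := by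
  classical
  induction p using MvPolynomial.induction_on' with
  | add p q hp hq =>
    obtain ⟨P, hP, hP'⟩ := hp
    obtain ⟨Q, hQ, hQ'⟩ := hq
    exact ⟨P + Q, by rw [map_add, hP, hQ, map_add], fun s => by
      rw [map_add, map_add, ← hP', ← hQ']; rfl⟩
  | monomial m c =>
    rw [← mul_one c, ← smul_eq_mul, ← smul_monomial]
    by_cases ht : Finsupp.weight (fun b : B => v.val b.1) m = ⊤
    -- A monomial of infinite weight contains some `b` with `v(b) = ∞`, whose initial form is `0`;
    -- it contributes nothing in any finite degree.
    · refine ⟨0, by rw [map_zero, map_smul, aeval_init_monomial_eq_zero m ht, smul_zero], fun s => ?_⟩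
      rw [map_smul, (isWeightedHomogeneous_monomial _ m 1 ht).weightedHomogeneousComponent_ne _
        (WithTop.coe_ne_top), smul_zero, map_zero]
      rfl
    · obtain ⟨r, hr⟩ := WithTop.ne_top_iff_exists.1 ht
      refine ⟨c • ⟨AddMonoidAlgebra.single r (evalAt B (monomial m (1 : k))),
        single_mem_gradedSubalgebra.2 (evalAt_monomial_mem_level hr.le)⟩, ?_, fun s => ?_⟩
      · rw [map_smul (aeval _), aeval_init_monomial m (evalAt_monomial_mem_level hr.le) hr.symm rfl]
        rfl
      · rw [map_smul, map_smul]
        change (c • AddMonoidAlgebra.single r _).coeff s = _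
        rw [AddMonoidAlgebra.coeff_smul_apply, AddMonoidAlgebra.coeff_single,
          Finsupp.single_apply]
        split_ifs with h
        · subst h
          rw [(isWeightedHomogeneous_monomial _ m 1 hr.symm).weightedHomogeneousComponent_same]
        · rw [(isWeightedHomogeneous_monomial _ m 1 hr.symm).weightedHomogeneousComponent_ne _
            (by simpa using Ne.symm h), map_zero]

/-- Vanishing in the associated graded algebra is tested degree by degree on the representative from
`exists_rees_eq_aeval_init`. The component of infinite weight imposes no condition. -/
lemma mem_initRelations_iff {p : MvPolynomial B k} :
    p ∈ v.initRelations B ↔ ∀ s : ℤ,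
      evalAt B (weightedHomogeneousComponent (fun b : B => v.val b.1) (s : WithTop ℤ) p) ∈
        v.level (s + 1) := by
  obtain ⟨P, hP, hP'⟩ := exists_rees_eq_aeval_init v p
  rw [Quasivaluation.initRelations, RingHom.mem_ker]
  change aeval (fun b : B => v.init b.1) p = 0 ↔ _
  rw [← hP, Ideal.Quotient.eq_zero_iff_mem]
  simp_rw [← hP']
  rfl

/-- This translates the subduction condition into a gain of one filtration step: for `p` of weight
`s` the representative is concentrated in degree `s`. -/
lemma toGr_eq_aeval_init_iff {p : MvPolynomial B k} {s : ℤ} {f : R} (hf : f ∈ v.level s)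
    (hp : IsOfWeight v p s) :
    v.toGr s f hf = aeval (fun b : B => v.init b.1) p ↔ f - evalAt B p ∈ v.level (s + 1) := by
  classical
  obtain ⟨P, hP, hP'⟩ := exists_rees_eq_aeval_init v p
  rw [← hP, Quasivaluation.toGr, Ideal.Quotient.eq]
  have key : ∀ r : ℤ, (AddMonoidAlgebra.single s f - P.1).coeff r =
      if s = r then f - evalAt B p else 0 := by
    intro r
    rw [AddMonoidAlgebra.coeff_sub, Finsupp.sub_apply, hP', AddMonoidAlgebra.coeff_single,
      Finsupp.single_apply]
    split_ifs with h
    · subst h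
      rw [IsWeightedHomogeneous.weightedHomogeneousComponent_same hp]
    · rw [IsWeightedHomogeneous.weightedHomogeneousComponent_ne _ hp (by simpa using Ne.symm h),
        map_zero, sub_zero]
  change (∀ r : ℤ, (AddMonoidAlgebra.single s f - P.1).coeff r ∈ v.level (r + 1)) ↔ _
  refine ⟨fun h => by simpa only [key, if_true] using h s, fun h r => ?_⟩
  rw [key]
  split_ifs with hr
  · exact hr ▸ h
  · exact Submodule.zero_mem _

/-- Here `p` is arbitrary: in degree `s` only its component of weight `s` is seen, so a polynomial
expressing an initial form can be replaced by that component. -/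
lemma sub_evalAt_component_mem_level {p : MvPolynomial B k} {s : ℤ} {f : R} (hf : f ∈ v.level s)
    (h : v.toGr s f hf = aeval (fun b : B => v.init b.1) p) :
    f - evalAt B (weightedHomogeneousComponent (fun b : B => v.val b.1) (s : WithTop ℤ) p) ∈
      v.level (s + 1) := by
  obtain ⟨P, hP, hP'⟩ := exists_rees_eq_aeval_init v p
  rw [← hP, Quasivaluation.toGr, Ideal.Quotient.eq] at h
  have h1 : (AddMonoidAlgebra.single s f - P.1).coeff s ∈ v.level (s + 1) := h s
  rwa [AddMonoidAlgebra.coeff_sub, Finsupp.sub_apply, hP', AddMonoidAlgebra.coeff_single,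
    Finsupp.single_eq_same] at h1

/-! ### The weight filtration -/

/-- The filtration step spanned by the monomials in the elements of `B` that have weight at least
`s`, where `b` has weight `v b`. -/
def weightFiltration (v : Quasivaluation k R) (B : Finset R) (s : ℤ) : Submodule k R :=
  (restrictSupport k {m : B →₀ ℕ |
    (s : WithTop ℤ) ≤ Finsupp.weight (fun b : B => v.val b.1) m}).map (evalAt B).toLinearMap

lemma mem_weightFiltration {s : ℤ} {f : R} : f ∈ weightFiltration v B s ↔
    ∃ p : MvPolynomial B k, (∀ m ∈ p.support,
      (s : WithTop ℤ) ≤ Finsupp.weight (fun b : B => v.val b.1) m) ∧ evalAt B p = f := Iff.rfl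

lemma weightFiltration_eq_span (s : ℤ) : weightFiltration v B s = Submodule.span k
    ((fun m => evalAt B (monomial m (1 : k))) '' {m : B →₀ ℕ |
      (s : WithTop ℤ) ≤ Finsupp.weight (fun b : B => v.val b.1) m}) := by
  rw [weightFiltration, restrictSupport_eq_span, Submodule.map_span, Set.image_image]
  rfl

lemma monomial_mem_weightFiltration {s : ℤ} {m : B →₀ ℕ}
    (h : (s : WithTop ℤ) ≤ Finsupp.weight (fun b : B => v.val b.1) m) :
    evalAt B (monomial m (1 : k)) ∈ weightFiltration v B s := by
  rw [weightFiltration_eq_span]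
  exact Submodule.subset_span ⟨m, h, rfl⟩

lemma weightFiltration_anti : Antitone (weightFiltration v B) := fun _ _ h =>
  Submodule.map_mono (restrictSupport_mono _ fun _ hm => le_trans (WithTop.coe_le_coe.2 h) hm)

lemma weightFiltration_le_level (s : ℤ) : weightFiltration v B s ≤ v.level s := by
  rw [weightFiltration_eq_span, Submodule.span_le]
  rintro _ ⟨m, hm, rfl⟩
  exact evalAt_monomial_mem_level hm

lemma mul_mem_weightFiltration {r s : ℤ} {f g : R} (hf : f ∈ weightFiltration v B r)
    (hg : g ∈ weightFiltration v B s) : f * g ∈ weightFiltration v B (r + s) := by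
  have h := Submodule.mul_mem_mul hf hg
  rw [weightFiltration_eq_span, weightFiltration_eq_span, Submodule.span_mul_span] at h
  rw [weightFiltration_eq_span]
  refine Submodule.span_mono ?_ h
  rintro _ ⟨_, ⟨m, hm, rfl⟩, _, ⟨m', hm', rfl⟩, rfl⟩
  refine ⟨m + m', ?_, ?_⟩
  · change _ ≤ Finsupp.weight (fun b : B => v.val b.1) (m + m')
    rw [map_add]
    push_cast
    exact add_le_add hm hm'
  · dsimp only
    rw [← map_mul, monomial_mul, one_mul]

lemma one_mem_weightFiltration : (1 : R) ∈ weightFiltration v B 0 := by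
  have := monomial_mem_weightFiltration (v := v) (k := k) (B := B) (s := 0) (m := 0) (by simp)
  rwa [show (monomial (0 : B →₀ ℕ) (1 : k)) = 1 from rfl, map_one] at this

lemma mem_weightFiltration_of_mem {s : ℤ} {b : R} (hb : b ∈ B) (h : b ∈ v.level s) :
    b ∈ weightFiltration v B s := by
  have := monomial_mem_weightFiltration (v := v) (k := k) (B := B) (s := s)
    (m := Finsupp.single ⟨b, hb⟩ 1) (by rw [Finsupp.weight_single, one_smul]; exact h)
  simpa [evalAt, ← X.eq_1] using this

lemma evalAt_mem_weightFiltration {p : MvPolynomial B k} {s : ℤ} {r : WithTop ℤ}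
    (hp : IsOfWeight v p r) (h : s ≤ r) : evalAt B p ∈ weightFiltration v B s :=
  mem_weightFiltration.2 ⟨p, fun _ hm => h.trans (hp (mem_support_iff.1 hm)).ge, rfl⟩

lemma weightFiltration_mono {B' : Finset R} (h : B ⊆ B') (s : ℤ) :
    weightFiltration v B s ≤ weightFiltration v B' s := by
  rw [weightFiltration_eq_span, Submodule.span_le]
  rintro _ ⟨m, hm, rfl⟩
  have hw : Finsupp.weight (fun b : B => v.val b.1) m =
      Finsupp.weight (fun b : B' => v.val b.1) (m.mapDomain (Set.inclusion h)) := by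
    clear hm
    induction m using finsupp_nat_induction with
    | zero => simp
    | add _ _ h1 h2 => rw [map_add, Finsupp.mapDomain_add, map_add, h1, h2]
    | single b => rw [Finsupp.mapDomain_single, Finsupp.weight_single, Finsupp.weight_single]
  have he : evalAt B (monomial m (1 : k)) =
      evalAt B' (monomial (m.mapDomain (Set.inclusion h)) (1 : k)) := by
    rw [← rename_monomial, evalAt, evalAt, aeval_rename]
    rfl
  dsimp only
  rw [he]
  exact monomial_mem_weightFiltration (hw ▸ hm)

/-- The starting point of every climb through the weight filtration. -/
lemma exists_mem_weightFiltration {f : R} (hf : f ∈ Algebra.adjoin k (B : Set R)) :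
    ∃ s, f ∈ weightFiltration v B s := by
  induction hf using Algebra.adjoin_induction with
  | mem b hb =>
    cases h : v.val b with
    | top => exact ⟨0, mem_weightFiltration_of_mem hb (by simp [Quasivaluation.mem_level, h])⟩
    | coe r => exact ⟨r, mem_weightFiltration_of_mem hb h.ge⟩
  | algebraMap c =>
    refine ⟨0, ?_⟩
    rw [Algebra.algebraMap_eq_smul_one]
    exact Submodule.smul_mem _ c one_mem_weightFiltration
  | add f g _ _ hf hg =>
    obtain ⟨r, hr⟩ := hf
    obtain ⟨s, hs⟩ := hg
    exact ⟨min r s, Submodule.add_mem _ (weightFiltration_anti (min_le_left r s) hr)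
      (weightFiltration_anti (min_le_right r s) hs)⟩
  | mul f g _ _ hf hg =>
    obtain ⟨r, hr⟩ := hf
    obtain ⟨s, hs⟩ := hg
    exact ⟨r + s, mul_mem_weightFiltration hr hs⟩

/-- An element of weight at least `s` is the value of a polynomial of weight `s` plus an element
of weight at least `s + 1`. -/
lemma exists_leading_component {s : ℤ} {f : R} (hf : f ∈ weightFiltration v B s) :
    ∃ p : MvPolynomial B k, IsOfWeight v p s ∧ f - evalAt B p ∈ weightFiltration v B (s + 1) := by
  classical
  obtain ⟨p, hp, rfl⟩ := mem_weightFiltration.1 hf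
  refine ⟨weightedHomogeneousComponent (fun b : B => v.val b.1) (s : WithTop ℤ) p,
    weightedHomogeneousComponent_isWeightedHomogeneous _ _, ?_⟩
  rw [← map_sub]
  refine mem_weightFiltration.2 ⟨_, fun m hm => ?_, rfl⟩
  rw [mem_support_iff, coeff_sub, coeff_weightedHomogeneousComponent] at hm
  split_ifs at hm with h
  · simp at hm
  · rw [sub_zero] at hm
    have h1 := hp m (mem_support_iff.2 hm)
    have h2 : (s : WithTop ℤ) < Finsupp.weight (fun b : B => v.val b.1) m :=
      lt_of_le_of_ne h1 (Ne.symm h)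
    revert h2
    -- Values are integers or `∞`, so a weight above `s` is at least `s + 1`.
    cases Finsupp.weight (fun b : B => v.val b.1) m with
    | top => simp
    | coe r =>
      intro h2
      have : s < r := by exact_mod_cast h2
      exact_mod_cast this

lemma evalAt_mem_level_succ {g : MvPolynomial B k} {s : ℤ} (hg : IsOfWeight v g s)
    (h : g ∈ v.initRelations B) : evalAt B g ∈ v.level (s + 1) := by
  have := mem_initRelations_iff.1 h s
  rwa [IsWeightedHomogeneous.weightedHomogeneousComponent_same hg] at this

/-- If generators of the ideal of relations among the initial forms lift to higher weight in `B'`,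
then so do all relations. -/
lemma component_mem_weightFiltration {B' : Finset R} (hB : B ⊆ B') {G : Set (MvPolynomial B k)}
    (homog : ∀ g ∈ G, ∃ s, IsOfWeight v g s)
    (lift : ∀ g ∈ G, ∀ s : ℤ, IsOfWeight v g s → evalAt B g ∈ weightFiltration v B' (s + 1))
    {p : MvPolynomial B k} (hp : p ∈ Ideal.span G) (s : ℤ) :
    evalAt B (weightedHomogeneousComponent (fun b : B => v.val b.1) (s : WithTop ℤ) p) ∈
      weightFiltration v B' (s + 1) := by
  induction hp using Submodule.closure_induction with
  | zero => simp
  | add p q _ _ hp hq => rw [map_add, map_add]; exact Submodule.add_mem _ hp hq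
  | smul_mem a g hg =>
    rw [smul_eq_mul]
    induction a using MvPolynomial.induction_on' with
    | add a b ha hb => rw [add_mul, map_add, map_add]; exact Submodule.add_mem _ ha hb
    | monomial m c =>
      obtain ⟨r, hr⟩ := homog g hg
      have h1 := (isWeightedHomogeneous_monomial (fun b : B => v.val b.1) m c rfl).mul hr
      by_cases h : (s : WithTop ℤ) = Finsupp.weight (fun b : B => v.val b.1) m + r
      · rw [h, h1.weightedHomogeneousComponent_same, map_mul]
        -- As `s` is finite, so are the weights `s1` of the monomial and `s2` of `g`; a generator of
        -- infinite weight never needs lifting. The monomial contributes `s1` and the lifted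
        -- generator `s2 + 1`.
        obtain ⟨s1, s2, hs1, hs2, rfl⟩ := WithTop.add_eq_coe.1 h.symm
        subst hs2
        rw [add_assoc]
        refine mul_mem_weightFiltration (weightFiltration_mono hB _ ?_) (lift g hg s2 hr)
        rw [← mul_one c, ← smul_eq_mul, ← smul_monomial, map_smul]
        exact Submodule.smul_mem _ _ (monomial_mem_weightFiltration hs1.le)
      · rw [h1.weightedHomogeneousComponent_ne _ h, map_zero]
        exact Submodule.zero_mem _

/-- Raising the weight along a completed pass. -/
lemma mem_weightFiltration_succ {B' : Finset R} (hB : B ⊆ B') {G : Set (MvPolynomial B k)}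
    (homog : ∀ g ∈ G, ∃ s, IsOfWeight v g s)
    (lift : ∀ g ∈ G, ∀ s : ℤ, IsOfWeight v g s → evalAt B g ∈ weightFiltration v B' (s + 1))
    (gen : Ideal.span G = v.initRelations B) {s : ℤ} {f : R}
    (hf : f ∈ weightFiltration v B s) (hf' : f ∈ v.level (s + 1)) :
    f ∈ weightFiltration v B' (s + 1) := by
  obtain ⟨p, hp, h⟩ := exists_leading_component hf
  have h1 : evalAt B p ∈ v.level (s + 1) := by
    have := Submodule.sub_mem _ hf' (weightFiltration_le_level _ h)
    rwa [sub_sub_cancel] at this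
  -- The leading component `p` has weight `s` but its value lies in level `s + 1`, so it is a
  -- relation among the initial forms.
  have h2 : p ∈ v.initRelations B := by
    rw [mem_initRelations_iff]
    intro r
    by_cases hr : (r : WithTop ℤ) = s
    · rw [hr, IsWeightedHomogeneous.weightedHomogeneousComponent_same hp]
      rwa [WithTop.coe_inj.1 hr]
    · rw [IsWeightedHomogeneous.weightedHomogeneousComponent_ne _ hp hr, map_zero]
      exact Submodule.zero_mem _
  have h3 := component_mem_weightFiltration hB homog lift (gen ▸ h2) s
  rw [IsWeightedHomogeneous.weightedHomogeneousComponent_same hp] at h3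
  have := Submodule.add_mem _ (weightFiltration_mono hB _ h) h3
  rwa [sub_add_cancel] at this

/-- The initial form of an element whose weight is its value lies in the algebra generated by the
initial forms of the elements of `B`. -/
lemma init_mem_adjoin {f : R} (hf : ∀ s : ℤ, f ∈ v.level s → f ∈ weightFiltration v B s) :
    v.init f ∈ Algebra.adjoin k (v.init '' (B : Set R)) := by
  by_cases ht : v.val f = ⊤
  · rw [v.init_eq_zero ht]; exact Subalgebra.zero_mem _
  obtain ⟨s, hs⟩ := WithTop.ne_top_iff_exists.1 ht
  obtain ⟨p, hp, h⟩ := exists_leading_component (hf s hs.le)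
  rw [v.init_eq_toGr hs.symm, (toGr_eq_aeval_init_iff hs.le hp).2 (weightFiltration_le_level _ h)]
  have : v.init '' (B : Set R) = Set.range fun b : B => v.init b.1 := by
    ext; simp
  rw [this]
  exact Algebra.adjoin_range_eq_range_aeval k (fun b : B => v.init b.1) ▸ ⟨p, rfl⟩

end Subduction

/-! ### The stages of the algorithm -/

section Stages

variable {k A : Type*} [Field k] [CommRing A] [Algebra k A] {n : ℕ}

lemma mem_level_laurent {Γ : Type*} [AddCommMonoid Γ] {v : Quasivaluation k A} {s : ℤ}
    {f : AddMonoidAlgebra A Γ} :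
    f ∈ (v.laurent Γ).level s ↔ ∀ r, f.coeff r ∈ v.level s := by
  change (s : WithTop ℤ) ≤ f.coeff.support.inf _ ↔ _
  rw [Finset.le_inf_iff]
  refine ⟨fun h r => ?_, fun h r _ => h r⟩
  by_cases hr : r ∈ f.coeff.support
  · exact h r hr
  · rw [Finsupp.notMem_support_iff.1 hr]; exact Submodule.zero_mem _

lemma single_mem_level_laurent {Γ : Type*} [AddCommMonoid Γ] {v : Quasivaluation k A} {s : ℤ}
    {r : Γ} {a : A} :
    AddMonoidAlgebra.single r a ∈ (v.laurent Γ).level s ↔ a ∈ v.level s := by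
  classical
  rw [mem_level_laurent]
  refine ⟨fun h => by simpa using h r, fun h s => ?_⟩
  rw [AddMonoidAlgebra.coeff_single, Finsupp.single_apply]
  split_ifs
  · exact h
  · exact Submodule.zero_mem _

lemma val_laurent_single {Γ : Type*} [AddCommMonoid Γ] (v : Quasivaluation k A) (r : Γ) (a : A) :
    (v.laurent Γ).val (AddMonoidAlgebra.single r a) = v.val a :=
  le_antisymm (le_of_forall_int_le fun _ h => single_mem_level_laurent.1 h)
    (le_of_forall_int_le fun _ h => single_mem_level_laurent.2 h)

lemma eq_zero_of_val_laurent {Γ : Type*} [AddCommMonoid Γ] {v : Quasivaluation k A}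
    (hv : ∀ f, v.val f = ⊤ → f = 0) {f : AddMonoidAlgebra A Γ} (hf : (v.laurent Γ).val f = ⊤) :
    f = 0 := by
  refine AddMonoidAlgebra.coeff_injective (Finsupp.ext fun r => hv _ ?_)
  exact top_le_iff.1 (le_of_forall_int_le fun s _ => mem_level_laurent.1
    (show (s : WithTop ℤ) ≤ (v.laurent Γ).val f by rw [hf]; exact le_top) r)

variable (𝒜 : ℕ → Submodule k A) (w : Fin n → Quasivaluation k A)

/-- The elements of a graded component of `A ⊗ T_n`, as a subspace. -/
def componentSubmodule (d : ℕ) (r : Fin n → ℤ) : Submodule k (Laurent A n) where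
  carrier := component 𝒜 d r
  add_mem' := by
    rintro _ _ ⟨a, ha, rfl⟩ ⟨b, hb, rfl⟩
    exact ⟨a + b, add_mem ha hb, (AddMonoidAlgebra.single_add ..).symm⟩
  zero_mem' := ⟨0, zero_mem _, (AddMonoidAlgebra.single_zero _).symm⟩
  smul_mem' := by
    rintro c _ ⟨a, ha, rfl⟩
    exact ⟨c • a, Submodule.smul_mem _ c ha, AddMonoidAlgebra.smul_single ..⟩

variable {𝒜 w}

lemma mem_componentSubmodule {d : ℕ} {r : Fin n → ℤ} {f : Laurent A n} :
    f ∈ componentSubmodule 𝒜 d r ↔ f ∈ component 𝒜 d r := Iff.rfl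

lemma evalAt_mem_component {d : ℕ} {r : Fin n → ℤ} {B : Finset (Laurent A n)}
    {p : MvPolynomial B k} (hp : IsMultihomogeneous 𝒜 d r p) :
    evalAt B p ∈ component 𝒜 d r := by
  rw [← mem_componentSubmodule, p.as_sum, map_sum]
  refine Submodule.sum_mem _ fun m hm => ?_
  rw [← mul_one (coeff m p), ← smul_eq_mul, ← smul_monomial, map_smul]
  exact Submodule.smul_mem _ _ (hp m hm)

lemma mem_partialRees {j : ℕ} {f : Laurent A n} : f ∈ partialRees w j ↔
    ∀ r, (∀ i : Fin n, i.1 < j → f.coeff r ∈ (w i).level (r i)) ∧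
      ((∃ i : Fin n, j ≤ i.1 ∧ r i ≠ 0) → f.coeff r = 0) := Iff.rfl

lemma single_mem_partialRees {j : ℕ} {r : Fin n → ℤ} {a : A} :
    AddMonoidAlgebra.single r a ∈ partialRees w j ↔
    (∀ i : Fin n, i.1 < j → a ∈ (w i).level (r i)) ∧
      ((∃ i : Fin n, j ≤ i.1 ∧ r i ≠ 0) → a = 0) := single_mem_gradedSubalgebra

variable (A) in
/-- The monomial `t_j^s`. -/
def varPow (j : Fin n) (s : ℤ) : Laurent A n := AddMonoidAlgebra.single (Pi.single j s) 1

lemma varPow_add (j : Fin n) (s s' : ℤ) :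
    varPow A j (s + s') = varPow A j s * varPow A j s' := by
  rw [varPow, varPow, varPow, AddMonoidAlgebra.single_mul_single, mul_one, Pi.single_add]

lemma varPow_zero (j : Fin n) : varPow A j 0 = 1 := by
  rw [varPow, Pi.single_zero, AddMonoidAlgebra.one_def]

lemma varPow_neg (j : Fin n) (e : ℕ) : varPow A j (-e) = varPow A j (-1) ^ e := by
  induction e with
  | zero => simp [varPow_zero]
  | succ e ih => rw [pow_succ, ← ih, ← varPow_add]; congr 1; push_cast; ring

lemma single_mul_varPow (r : Fin n → ℤ) (a : A) (j : Fin n) (s : ℤ) :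
    AddMonoidAlgebra.single r a * varPow A j s = AddMonoidAlgebra.single (r + Pi.single j s) a := by
  rw [varPow, AddMonoidAlgebra.single_mul_single, mul_one]

lemma update_add_single (r : Fin n → ℤ) (j : Fin n) :
    Function.update r j 0 + Pi.single j (r j) = r := by
  ext i
  by_cases h : i = j
  · subst h; simp
  · simp [h]

lemma mem_of_single_mem {P : AddSubmonoid (Laurent A n)} {f : Laurent A n}
    (h : ∀ r, AddMonoidAlgebra.single r (f.coeff r) ∈ P) : f ∈ P := by
  rw [← AddMonoidAlgebra.sum_coeff_single f]
  exact P.sum_mem fun r _ => h r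

/-! ### Completeness and the Rees lift -/

variable (w) in
/-- Every element of `R_j` has weight its value with respect to `B`. -/
def IsComplete (j : Fin n) (B : Finset (Laurent A n)) : Prop :=
  ∀ s : ℤ, ∀ f ∈ partialRees w j, f ∈ (extVal w j).level s →
    f ∈ weightFiltration (extVal w j) B s

variable (w) in
/-- The subalgebra `⨁ W_{r_j} t^r`, where `W` is the weight filtration of `B`. -/
def weightSubalgebra (j : Fin n) (B : Finset (Laurent A n)) : Subalgebra k (Laurent A n) :=
  gradedSubalgebra
    -- The exponent of `t_j` serves as the filtration degree and is erased from the element itself,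
    -- since elements of `R_j` do not involve `t_j`.
    (fun r : Fin n → ℤ => (weightFiltration (extVal w j) B (r j)).comap
      (AddMonoidAlgebra.lsingle (R := k) (Function.update r j 0)))
    (by
      have : Function.update (0 : Fin n → ℤ) j 0 = 0 := by simp
      rw [Submodule.mem_comap, AddMonoidAlgebra.lsingle_apply, this, ← AddMonoidAlgebra.one_def]
      exact one_mem_weightFiltration)
    (fun r s a b ha hb => by
      rw [Submodule.mem_comap, AddMonoidAlgebra.lsingle_apply] at *
      have : Function.update (r + s) j 0 = Function.update r j 0 + Function.update s j 0 := by
        rw [← Function.update_add, add_zero]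
      rw [this, ← AddMonoidAlgebra.single_mul_single]
      exact mul_mem_weightFiltration ha hb)

lemma mem_weightSubalgebra {j : Fin n} {B : Finset (Laurent A n)} {f : Laurent A n} :
    f ∈ weightSubalgebra w j B ↔ ∀ r : Fin n → ℤ,
      AddMonoidAlgebra.single (Function.update r j 0) (f.coeff r) ∈
        weightFiltration (extVal w j) B (r j) := Iff.rfl

/-- Together with `single_add_mem_partialRees` this exhibits `R_{j+1}` as the Rees algebra of `R_j`:
an exponent of `t_j` is traded for a filtration level. -/
lemma single_update_mem_partialRees {j : Fin n} {r : Fin n → ℤ} {a : A}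
    (h : AddMonoidAlgebra.single r a ∈ partialRees w (j + 1)) :
    AddMonoidAlgebra.single (Function.update r j 0) a ∈ partialRees w j ∧
      AddMonoidAlgebra.single (Function.update r j 0) a ∈ (extVal w j).level (r j) := by
  rw [single_mem_partialRees] at *
  refine ⟨⟨fun i hi => ?_, ?_⟩, single_mem_level_laurent.2 (h.1 j (Nat.lt_succ_self _))⟩
  · rw [Function.update_of_ne (by rintro rfl; exact lt_irrefl _ hi)]
    exact h.1 i (hi.trans (Nat.lt_succ_self _))
  · rintro ⟨i, hi, h'⟩
    have hij : i ≠ j := by rintro rfl; simp at h'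
    rw [Function.update_of_ne hij] at h'
    refine h.2 ⟨i, ?_, h'⟩
    have : i.1 ≠ j.1 := fun h => hij (Fin.ext h)
    omega

lemma single_add_mem_partialRees {j : Fin n} {r : Fin n → ℤ} {a : A} {s : ℤ}
    (h : AddMonoidAlgebra.single r a ∈ partialRees w j) (ha : a ∈ (w j).level s) :
    AddMonoidAlgebra.single (r + Pi.single j s) a ∈ partialRees w (j + 1) := by
  rw [single_mem_partialRees] at *
  constructor
  · intro i hi
    by_cases hij : i = j
    · subst hij
      by_cases h0 : r i = 0
      · simpa [h0] using ha
      · rw [h.2 ⟨i, le_rfl, h0⟩]; exact Submodule.zero_mem _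
    · have : i.1 ≠ j.1 := fun h => hij (Fin.ext h)
      rw [Pi.add_apply, Pi.single_eq_of_ne hij, add_zero]
      exact h.1 i (by omega)
  · rintro ⟨i, hi, h'⟩
    have hij : i ≠ j := by rintro rfl; omega
    rw [Pi.add_apply, Pi.single_eq_of_ne hij, add_zero] at h'
    exact h.2 ⟨i, by omega, h'⟩

lemma single_coeff_mem_partialRees {j : ℕ} {f : Laurent A n} (hf : f ∈ partialRees w j)
    (r : Fin n → ℤ) : AddMonoidAlgebra.single r (f.coeff r) ∈ partialRees w j :=
  single_mem_partialRees.2 (mem_partialRees.1 hf r)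

/-- Completeness becomes an inclusion of subalgebras, which can be checked on finitely many
generators of `R_{j+1}`; termination rests on this form. -/
lemma partialRees_le_weightSubalgebra_iff {j : Fin n} {B : Finset (Laurent A n)} :
    partialRees w (j + 1) ≤ weightSubalgebra w j B ↔ IsComplete w j B := by
  constructor
  · intro h s f hf hs
    refine mem_of_single_mem (P := (weightFiltration _ B s).toAddSubmonoid) fun r => ?_
    have h1 := h (single_add_mem_partialRees (single_coeff_mem_partialRees hf r)
      (mem_level_laurent.1 hs r))
    have h2 := mem_weightSubalgebra.1 h1 (r + Pi.single j s)
    rw [AddMonoidAlgebra.coeff_single, Finsupp.single_eq_same] at h2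
    by_cases h0 : r j = 0
    · have h3 : Function.update (r + Pi.single j s) j 0 = r := by
        ext i
        by_cases hi : i = j
        · subst hi; simp [h0]
        · simp [hi]
      rw [h3] at h2
      simpa [h0] using h2
    · rw [(mem_partialRees.1 hf r).2 ⟨j, le_rfl, h0⟩, AddMonoidAlgebra.single_zero]
      exact Submodule.zero_mem _
  · intro h f hf r
    obtain ⟨h1, h2⟩ := single_update_mem_partialRees (single_coeff_mem_partialRees hf r)
    exact h _ _ h1 h2

open Classical in
lemma varPow_neg_one_mem_reesLift (j : Fin n) (B : Finset (Laurent A n)) :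
    varPow A j (-1) ∈ reesLift w j B := Finset.mem_insert_self _ _

/-- A monomial of finite weight `r` times `t_j^r` is the product of the lifts of its factors, and
powers of `t_j⁻¹` lower the exponent from `r` to `s`. -/
lemma mul_varPow_mem_adjoin_reesLift {j : Fin n} {B : Finset (Laurent A n)}
    (hw : ∀ f, (w j).val f = ⊤ → f = 0) {s : ℤ} {f : Laurent A n}
    (hf : f ∈ weightFiltration (extVal w j) B s) :
    f * varPow A j s ∈ Algebra.adjoin k (reesLift w j B : Set (Laurent A n)) := by
  classical
  have key : ∀ (m : B →₀ ℕ) (r : ℤ),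
      Finsupp.weight (fun b : B => (extVal w j).val b.1) m = r →
      evalAt B (monomial m (1 : k)) * varPow A j r ∈
        Algebra.adjoin k (reesLift w j B : Set (Laurent A n)) := by
    intro m
    induction m using finsupp_nat_induction with
    | zero =>
      intro r hr
      have : r = 0 := by rw [map_zero] at hr; exact_mod_cast hr.symm
      subst this
      rw [show (monomial (0 : B →₀ ℕ) (1 : k)) = 1 from rfl, map_one, varPow_zero, one_mul]
      exact Subalgebra.one_mem _
    | add m m' h1 h2 =>
      intro r h
      rw [map_add] at h
      obtain ⟨r, r', hr, hr', rfl⟩ := WithTop.add_eq_coe.1 h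
      rw [← one_mul (1 : k), ← monomial_mul, map_mul, varPow_add, mul_mul_mul_comm]
      exact Subalgebra.mul_mem _ (h1 r hr.symm) (h2 r' hr'.symm)
    | single b =>
      intro r h
      rw [Finsupp.weight_single, one_smul] at h
      refine Algebra.subset_adjoin (Finset.mem_insert_of_mem (Finset.mem_image.2 ⟨b.1, b.2, ?_⟩))
      rw [h, WithTop.untopD_coe, varPow]
      simp [evalAt, ← X.eq_1]
  rw [weightFiltration_eq_span] at hf
  induction hf using Submodule.span_induction with
  | zero => rw [zero_mul]; exact Subalgebra.zero_mem _
  | add f g _ _ hf hg => rw [add_mul]; exact Subalgebra.add_mem _ hf hg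
  | smul c f _ hf => rw [smul_mul_assoc]; exact Subalgebra.smul_mem _ hf c
  | mem f hf =>
    obtain ⟨m, hm, rfl⟩ := hf
    cases hr : Finsupp.weight (fun b : B => (extVal w j).val b.1) m with
    | top =>
      -- A monomial of infinite weight has infinite value, hence is zero; no lift could produce it
      -- otherwise.
      have : evalAt B (monomial m (1 : k)) = 0 := eq_zero_of_val_laurent hw
        (top_le_iff.1 (hr ▸ weight_le_val (v := extVal w j) m))
      dsimp only
      rw [this, zero_mul]
      exact Subalgebra.zero_mem _
    | coe r =>
      have h1 : s ≤ r := WithTop.coe_le_coe.1 (hr ▸ hm : (s : WithTop ℤ) ≤ r)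
      obtain ⟨e, he⟩ := Int.eq_ofNat_of_zero_le (sub_nonneg.2 h1)
      have h2 : s = r + -(e : ℤ) := by omega
      rw [h2, varPow_add, varPow_neg, ← mul_assoc]
      exact Subalgebra.mul_mem _ (key m r hr)
        (Subalgebra.pow_mem _ (Algebra.subset_adjoin (varPow_neg_one_mem_reesLift j B)) e)

variable (𝒜 w) in
/-- A finite set of homogeneous generators of `R_j`. -/
structure IsStageGenerators (j : ℕ) (B : Finset (Laurent A n)) : Prop where
  homogeneous : ∀ b ∈ B, ∃ d r, b ∈ component 𝒜 d r
  adjoin_eq : Algebra.adjoin k (B : Set (Laurent A n)) = partialRees w j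

lemma IsStageGenerators.mem {j : ℕ} {B : Finset (Laurent A n)} (hB : IsStageGenerators 𝒜 w j B)
    {b : Laurent A n} (hb : b ∈ B) : b ∈ partialRees w j :=
  hB.adjoin_eq ▸ Algebra.subset_adjoin hb

/-- Each use of `h` raises the weight by one, and the start `r` and the target `s` are integers; so
the climb is finite even if the values on `R_j` are unbounded. -/
lemma IsStageGenerators.isComplete {j : Fin n} {B : Finset (Laurent A n)}
    (hB : IsStageGenerators 𝒜 w j B)
    (h : ∀ (s : ℤ) (f : Laurent A n), f ∈ weightFiltration (extVal w j) B s →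
      f ∈ (extVal w j).level (s + 1) → f ∈ weightFiltration (extVal w j) B (s + 1)) :
    IsComplete w j B := by
  intro s f hf hs
  obtain ⟨r, hr⟩ := exists_mem_weightFiltration (v := extVal w j) (hB.adjoin_eq ▸ hf)
  have key : ∀ e : ℕ, r + e ≤ s → f ∈ weightFiltration (extVal w j) B (r + e) := by
    intro e
    induction e with
    | zero => intro _; simpa using hr
    | succ e ih =>
      intro he
      push_cast at he ⊢
      rw [← add_assoc] at he ⊢
      exact h _ _ (ih (by omega)) ((extVal w j).level_anti he hs)
  by_cases hrs : r ≤ s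
  · obtain ⟨e, he⟩ := Int.eq_ofNat_of_zero_le (sub_nonneg.2 hrs)
    have : s = r + e := by omega
    exact this ▸ key e this.ge
  · exact weightFiltration_anti (by omega) hr

lemma IsStageGenerators.reesLift {j : Fin n} {B : Finset (Laurent A n)}
    [SetLike.GradedMonoid 𝒜] (hB : IsStageGenerators 𝒜 w j B)
    (hw : ∀ f, (w j).val f = ⊤ → f = 0) (hc : IsComplete w j B) :
    IsStageGenerators 𝒜 w (j + 1) (reesLift w j B) := by
  classical
  constructor
  · intro b hb
    obtain rfl | hb := Finset.mem_insert.1 hb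
    · exact ⟨0, _, 1, SetLike.one_mem_graded 𝒜, rfl⟩
    · obtain ⟨b, hb', rfl⟩ := Finset.mem_image.1 hb
      obtain ⟨d, r, a, ha, rfl⟩ := hB.homogeneous b hb'
      exact ⟨d, _, a, ha, single_mul_varPow ..⟩
  · apply le_antisymm
    · refine Algebra.adjoin_le fun b hb => ?_
      obtain rfl | hb := Finset.mem_insert.1 hb
      · refine single_mem_partialRees.2 ⟨fun i hi => ?_, ?_⟩
        · refine (w i).level_anti ?_ (w i).one_mem_level
          by_cases h : i = j
          · subst h; simp
          · simp [h]
        · rintro ⟨i, hi, h⟩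
          exact absurd (Pi.single_eq_of_ne (by rintro rfl; omega) _) h
      · obtain ⟨b, hb', rfl⟩ := Finset.mem_image.1 hb
        obtain ⟨d, r, a, ha, rfl⟩ := hB.homogeneous b hb'
        -- An element of infinite value is lifted with the default exponent `0`, which is harmless
        -- since it lies in every level.
        have := single_add_mem_partialRees (s := ((extVal w j).val
          (AddMonoidAlgebra.single r a)).untopD 0) (hB.mem hb') (by
            rw [val_laurent_single, Quasivaluation.mem_level]
            cases (w j).val a <;> simp)
        rwa [← single_mul_varPow] at this
    · intro f hf
      refine mem_of_single_mem (P := (Algebra.adjoin k _).toSubmodule.toAddSubmonoid) fun r => ?_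
      obtain ⟨h1, h2⟩ := single_update_mem_partialRees (single_coeff_mem_partialRees hf r)
      have := mul_varPow_mem_adjoin_reesLift hw (hc _ _ h1 h2)
      rwa [single_mul_varPow, update_add_single] at this

end Stages

/-! ### Homogeneous choices -/

section Homogeneous

variable {k A : Type*} [Field k] [CommRing A] [Algebra k A] {n : ℕ}
  (𝒜 : ℕ → Submodule k A) [GradedAlgebra 𝒜]

/-- The projection of `A ⊗ T_n` to the component of degree `(d, r)`. -/
def projComponent (d : ℕ) (r : Fin n → ℤ) : Laurent A n →ₗ[k] Laurent A n :=
  AddMonoidAlgebra.lsingle r ∘ₗ GradedAlgebra.proj 𝒜 d ∘ₗ Finsupp.lapply r ∘ₗ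
    (AddMonoidAlgebra.coeffLinearEquiv k).toLinearMap

variable {𝒜}

lemma projComponent_apply (d : ℕ) (r : Fin n → ℤ) (f : Laurent A n) :
    projComponent 𝒜 d r f =
      AddMonoidAlgebra.single r (DirectSum.decompose 𝒜 (f.coeff r) d : A) := rfl

lemma projComponent_of_mem {d : ℕ} {r : Fin n → ℤ} {f : Laurent A n}
    (hf : f ∈ component 𝒜 d r) : projComponent 𝒜 d r f = f := by
  obtain ⟨a, ha, rfl⟩ := hf
  rw [projComponent_apply, AddMonoidAlgebra.coeff_single, Finsupp.single_eq_same,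
    DirectSum.decompose_of_mem_same 𝒜 ha]

lemma projComponent_of_mem_ne {d d' : ℕ} {r r' : Fin n → ℤ} {f : Laurent A n}
    (hf : f ∈ component 𝒜 d r) (h : (d, r) ≠ (d', r')) : projComponent 𝒜 d' r' f = 0 := by
  obtain ⟨a, ha, rfl⟩ := hf
  rw [projComponent_apply, AddMonoidAlgebra.coeff_single]
  by_cases hr : r = r'
  · subst hr
    rw [Finsupp.single_eq_same, DirectSum.decompose_of_mem_ne 𝒜 ha (by rintro rfl; exact h rfl),
      AddMonoidAlgebra.single_zero]
  · rw [Finsupp.single_eq_of_ne' hr, DirectSum.decompose_zero]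
    simp

lemma component_unique {d d' : ℕ} {r r' : Fin n → ℤ} {f : Laurent A n} (h0 : f ≠ 0)
    (hf : f ∈ component 𝒜 d r) (hf' : f ∈ component 𝒜 d' r') : (d, r) = (d', r') := by
  by_contra h
  exact h0 ((projComponent_of_mem hf').symm.trans (projComponent_of_mem_ne hf h))

lemma mul_mem_component {d d' : ℕ} {r r' : Fin n → ℤ} {f g : Laurent A n}
    (hf : f ∈ component 𝒜 d r) (hg : g ∈ component 𝒜 d' r') :
    f * g ∈ component 𝒜 (d + d') (r + r') := by
  obtain ⟨a, ha, rfl⟩ := hf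
  obtain ⟨b, hb, rfl⟩ := hg
  exact ⟨a * b, SetLike.mul_mem_graded ha hb, AddMonoidAlgebra.single_mul_single ..⟩

variable {w : Fin n → Quasivaluation k A} {j : Fin n}

lemma projComponent_mem_level
    (hw : ∀ f (d : ℕ), (w j).val f ≤ (w j).val (DirectSum.decompose 𝒜 f d : A))
    {s : ℤ} {f : Laurent A n} (hf : f ∈ (extVal w j).level s) (d : ℕ) (r : Fin n → ℤ) :
    projComponent 𝒜 d r f ∈ (extVal w j).level s := by
  rw [projComponent_apply, single_mem_level_laurent]
  exact (mem_level_laurent.1 hf r).trans (hw _ d)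

variable {B : Finset (Laurent A n)} {deg : B → ℕ × (Fin n → ℤ)}

/-- The weights for the grading of polynomials in the elements of `B` by value and degree. -/
def fullWeight (w : Fin n → Quasivaluation k A) (j : Fin n) (deg : B → ℕ × (Fin n → ℤ)) (b : B) :
    WithTop ℤ × ℕ × (Fin n → ℤ) := ((extVal w j).val b.1, deg b)

lemma weight_fullWeight (m : B →₀ ℕ) : Finsupp.weight (fullWeight w j deg) m =
    (Finsupp.weight (fun b : B => (extVal w j).val b.1) m, Finsupp.weight deg m) := by
  induction m using finsupp_nat_induction with
  | zero => simp only [map_zero]; rfl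
  | add _ _ h1 h2 => rw [map_add, map_add, map_add, h1, h2]; rfl
  | single b =>
    rw [Finsupp.weight_single, Finsupp.weight_single, Finsupp.weight_single, one_smul, one_smul,
      one_smul]
    rfl

lemma evalAt_monomial_mem_component (hdeg : ∀ b : B, b.1 ∈ component 𝒜 (deg b).1 (deg b).2)
    (m : B →₀ ℕ) : evalAt B (monomial m (1 : k)) ∈
      component 𝒜 (Finsupp.weight deg m).1 (Finsupp.weight deg m).2 := by
  induction m using finsupp_nat_induction with
  | zero =>
    rw [map_zero, show (monomial (0 : B →₀ ℕ) (1 : k)) = 1 from rfl, map_one]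
    exact ⟨1, SetLike.one_mem_graded 𝒜, AddMonoidAlgebra.one_def⟩
  | add m m' h h' =>
    rw [map_add, ← one_mul (1 : k), ← monomial_mul, map_mul]
    exact mul_mem_component h h'
  | single b =>
    rw [Finsupp.weight_single, one_smul]
    simpa [evalAt, ← X.eq_1] using hdeg b

/-- Each monomial takes a homogeneous value, so projecting the value amounts to projecting the
polynomial. This makes the homogeneous choices possible. -/
lemma projComponent_evalAt (hdeg : ∀ b : B, b.1 ∈ component 𝒜 (deg b).1 (deg b).2)
    (s : WithTop ℤ) (d : ℕ) (r : Fin n → ℤ) (p : MvPolynomial B k) :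
    projComponent 𝒜 d r
      (evalAt B (weightedHomogeneousComponent (fun b : B => (extVal w j).val b.1) s p)) =
      evalAt B (weightedHomogeneousComponent (fullWeight w j deg) (s, d, r) p) := by
  induction p using MvPolynomial.induction_on' with
  | add p q hp hq => rw [map_add, map_add, map_add, map_add, map_add, hp, hq]
  | monomial m c =>
    rw [← mul_one c, ← smul_eq_mul, ← smul_monomial, map_smul, map_smul, map_smul, map_smul,
      map_smul]
    congr 1
    have h1 := isWeightedHomogeneous_monomial (fun b : B => (extVal w j).val b.1) m (1 : k) rfl
    have h2 := isWeightedHomogeneous_monomial (fullWeight w j deg) m (1 : k) (weight_fullWeight m)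
    have h3 := evalAt_monomial_mem_component (k := k) hdeg m
    by_cases hs : s = Finsupp.weight (fun b : B => (extVal w j).val b.1) m
    · rw [hs, h1.weightedHomogeneousComponent_same]
      by_cases hd : Finsupp.weight deg m = (d, r)
      · rw [← hd, h2.weightedHomogeneousComponent_same]
        rw [hd] at h3
        exact projComponent_of_mem h3
      · rw [h2.weightedHomogeneousComponent_ne _ (fun h => hd (Prod.ext_iff.1 h).2.symm),
          projComponent_of_mem_ne h3 hd, map_zero]
    · rw [h1.weightedHomogeneousComponent_ne _ hs,
        h2.weightedHomogeneousComponent_ne _ (fun h => hs (Prod.ext_iff.1 h).1), map_zero, map_zero]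

lemma isOfWeight_of_fullWeight {p : MvPolynomial B k} {s : WithTop ℤ} {e : ℕ × (Fin n → ℤ)}
    (hp : IsWeightedHomogeneous (fullWeight w j deg) p (s, e)) : IsOfWeight (extVal w j) p s :=
  fun m hm => by
    have := hp hm
    rw [weight_fullWeight] at this
    exact (Prod.ext_iff.1 this).1

lemma isMultihomogeneous_of_fullWeight (hdeg : ∀ b : B, b.1 ∈ component 𝒜 (deg b).1 (deg b).2)
    {p : MvPolynomial B k} {s : WithTop ℤ} {d : ℕ} {r : Fin n → ℤ}
    (hp : IsWeightedHomogeneous (fullWeight w j deg) p (s, d, r)) :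
    IsMultihomogeneous 𝒜 d r p := fun m hm => by
  have h1 := hp (mem_support_iff.1 hm)
  rw [weight_fullWeight] at h1
  have h2 := evalAt_monomial_mem_component (k := k) hdeg m
  have h3 : Finsupp.weight deg m = (d, r) := (Prod.ext_iff.1 h1).2
  rwa [h3] at h2

/-- The levels are stable under projection to components, so the ideal of relations is homogeneous
for the full weight; the Hilbert basis theorem then selects finitely many homogeneous generators.
Hence a pass can always be started. -/
lemma exists_homogeneous_generators (hB : ∀ b ∈ B, ∃ d r, b ∈ component 𝒜 d r)
    (hw : ∀ f (d : ℕ), (w j).val f ≤ (w j).val (DirectSum.decompose 𝒜 f d : A)) :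
    ∃ G : List (MvPolynomial B k),
      (∀ g ∈ G, (∃ s, IsOfWeight (extVal w j) g s) ∧ ∃ d r, IsMultihomogeneous 𝒜 d r g) ∧
      Ideal.span {g | g ∈ G} = (extVal w j).initRelations B := by
  choose deg₁ deg₂ hdeg using fun b : B => hB b.1 b.2
  let deg : B → ℕ × (Fin n → ℤ) := fun b => (deg₁ b, deg₂ b)
  let S : Set (MvPolynomial B k) := {g | g ∈ (extVal w j).initRelations B ∧
    ∃ c, IsWeightedHomogeneous (fullWeight w j deg) g c}
  have hS : Ideal.span S = (extVal w j).initRelations B := by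
    refine le_antisymm (Ideal.span_le.2 fun g hg => hg.1) fun p hp => ?_
    rw [← finsum_weightedHomogeneousComponent (fullWeight w j deg) p]
    refine finsum_induction (· ∈ Ideal.span S) (Ideal.zero_mem _) (fun _ _ => Ideal.add_mem _)
      fun c => Ideal.subset_span
        ⟨?_, c, weightedHomogeneousComponent_isWeightedHomogeneous c p⟩
    obtain ⟨s, d, r⟩ := c
    have hc := weightedHomogeneousComponent_isWeightedHomogeneous (w := fullWeight w j deg)
      (s, d, r) p
    have hc' := isOfWeight_of_fullWeight hc
    rw [mem_initRelations_iff]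
    intro s'
    by_cases hs : (s' : WithTop ℤ) = s
    · subst hs
      rw [IsWeightedHomogeneous.weightedHomogeneousComponent_same hc',
        ← projComponent_evalAt (𝒜 := 𝒜) hdeg]
      exact projComponent_mem_level hw (mem_initRelations_iff.1 hp s') d r
    · rw [IsWeightedHomogeneous.weightedHomogeneousComponent_ne _ hc' hs, map_zero]
      exact Submodule.zero_mem _
  obtain ⟨G, hG, hG'⟩ := (Submodule.fg_span_iff_fg_span_finset_subset S).1
    (IsNoetherian.noetherian (Ideal.span S))
  refine ⟨G.toList, fun g hg => ?_, ?_⟩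
  · obtain ⟨_, ⟨s, d, r⟩, hc⟩ := hG (Finset.mem_toList.1 hg)
    exact ⟨⟨s, isOfWeight_of_fullWeight hc⟩, d, r, isMultihomogeneous_of_fullWeight hdeg hc⟩
  · rw [← hS]
    simp only [Finset.mem_toList]
    exact hG'.symm

/-- Any polynomial expressing the initial form may be cut down to its component of weight `v(h)` and
degree `(d, r)`, so insisting on homogeneity never blocks a subduction. -/
lemma exists_homogeneous_subduction (hB : ∀ b ∈ B, ∃ d r, b ∈ component 𝒜 d r)
    (hw : ∀ f (d : ℕ), (w j).val f ≤ (w j).val (DirectSum.decompose 𝒜 f d : A))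
    {h : Laurent A n} {d : ℕ} {r : Fin n → ℤ} (hh : h ∈ component 𝒜 d r)
    (ht : (extVal w j).val h ≠ ⊤)
    (hi : (extVal w j).init h ∈
      Algebra.adjoin k ((extVal w j).init '' (B : Set (Laurent A n)))) :
    ∃ p : MvPolynomial B k, IsOfWeight (extVal w j) p ((extVal w j).val h) ∧
      IsMultihomogeneous 𝒜 d r p ∧
      (extVal w j).init h = MvPolynomial.aeval (fun b : B => (extVal w j).init b.1) p := by
  choose deg₁ deg₂ hdeg using fun b : B => hB b.1 b.2
  let deg : B → ℕ × (Fin n → ℤ) := fun b => (deg₁ b, deg₂ b)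
  have himage : (extVal w j).init '' (B : Set (Laurent A n)) =
      Set.range fun b : B => (extVal w j).init b.1 := by
    ext; simp
  rw [himage] at hi
  replace hi : (extVal w j).init h ∈
    (aeval (R := k) fun b : B => (extVal w j).init b.1).range :=
    Algebra.adjoin_range_eq_range_aeval k (fun b : B => (extVal w j).init b.1) ▸ hi
  obtain ⟨p, hp⟩ := hi
  obtain ⟨s, hs⟩ := WithTop.ne_top_iff_exists.1 ht
  have hc := weightedHomogeneousComponent_isWeightedHomogeneous (w := fullWeight w j deg)
      (s, d, r) p
  have hc' := isOfWeight_of_fullWeight hc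
  refine ⟨_, hs ▸ hc', isMultihomogeneous_of_fullWeight hdeg hc, ?_⟩
  have hp' : (extVal w j).toGr s h hs.le = aeval (fun b : B => (extVal w j).init b.1) p :=
    ((extVal w j).init_eq_toGr hs.symm).symm.trans hp.symm
  rw [(extVal w j).init_eq_toGr hs.symm, toGr_eq_aeval_init_iff hs.le hc',
    ← projComponent_evalAt (𝒜 := 𝒜) hdeg]
  have := projComponent_mem_level hw (sub_evalAt_component_mem_level hs.le hp') d r
  rwa [map_sub, projComponent_of_mem hh] at this

end Homogeneous

/-! ### Invariants of the algorithm -/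

section Invariants

variable {k A : Type*} [Field k] [CommRing A] [Algebra k A] {n : ℕ}

/-- The invariant of a pass that started with `B₀`. -/
structure PassInvariant (𝒜 : ℕ → Submodule k A) (w : Fin n → Quasivaluation k A) (j : Fin n)
    (B₀ B : Finset (Laurent A n)) (todo : List (Laurent A n)) : Prop where
  generators₀ : IsStageGenerators 𝒜 w j B₀
  generators : IsStageGenerators 𝒜 w j B
  subset : B₀ ⊆ B
  -- This clause stops the loop: a pass that starts from a complete set ends in `advance`.
  eq_of_isComplete : IsComplete w j B₀ → B = B₀
  todo_homogeneous : ∀ h ∈ todo, ∃ d r, h ∈ component 𝒜 d r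
  todo_mem : ∀ h ∈ todo, h ∈ partialRees w j
  -- Each `g(B₀)` in level `s` either has weight at least `s` in terms of `B` or differs from such
  -- an element by a pending `h` in level `s`.
  lift : ∃ G : Set (MvPolynomial B₀ k), (∀ g ∈ G, ∃ s, IsOfWeight (extVal w j) g s) ∧
    Ideal.span G = (extVal w j).initRelations B₀ ∧
    ∀ g ∈ G, ∀ s, evalAt B₀ g ∈ (extVal w j).level s →
      evalAt B₀ g ∈ weightFiltration (extVal w j) B s ∨
      ∃ h ∈ todo, h ∈ (extVal w j).level s ∧
        evalAt B₀ g - h ∈ weightFiltration (extVal w j) B s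

variable {𝒜 : ℕ → Submodule k A} {w : Fin n → Quasivaluation k A} {j : Fin n}
  {B₀ B : Finset (Laurent A n)} {todo : List (Laurent A n)}

/-- With nothing pending, the second alternative in `lift` is void, so all chosen generators have
been lifted to higher weight. -/
lemma PassInvariant.mem_weightFiltration_succ (H : PassInvariant 𝒜 w j B₀ B []) {s : ℤ}
    {f : Laurent A n} (hf : f ∈ weightFiltration (extVal w j) B₀ s)
    (hf' : f ∈ (extVal w j).level (s + 1)) : f ∈ weightFiltration (extVal w j) B (s + 1) := by
  obtain ⟨G, homog, gen, lift⟩ := H.lift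
  refine StrongKhovanskii.mem_weightFiltration_succ H.subset homog (fun g hg r hr => ?_) gen hf hf'
  obtain h | ⟨h, hh, _⟩ := lift g hg (r + 1)
    (evalAt_mem_level_succ hr (gen ▸ Ideal.subset_span hg))
  · exact h
  · simp at hh

lemma PassInvariant.isComplete (H : PassInvariant 𝒜 w j B B []) : IsComplete w j B :=
  H.generators.isComplete fun _ _ hf hf' => H.mem_weightFiltration_succ hf hf'

lemma evalAt_mem_adjoin {R : Type*} [CommRing R] [Algebra k R] {B : Finset R}
    (p : MvPolynomial B k) : evalAt B p ∈ Algebra.adjoin k (B : Set R) := by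
  have := Algebra.adjoin_range_eq_range_aeval k fun b : B => b.1
  rw [Subtype.range_coe_subtype] at this
  exact this ▸ ⟨p, rfl⟩

lemma PassInvariant.start (hB : IsStageGenerators 𝒜 w j B) {G : List (MvPolynomial B k)}
    (homog : ∀ g ∈ G, (∃ s, IsOfWeight (extVal w j) g s) ∧ ∃ d r, IsMultihomogeneous 𝒜 d r g)
    (gen : Ideal.span {g | g ∈ G} = (extVal w j).initRelations B) :
    PassInvariant 𝒜 w j B B (G.map (evalAt B)) where
  generators₀ := hB
  generators := hB
  subset := Finset.Subset.refl _
  eq_of_isComplete := fun _ => rfl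
  todo_homogeneous := fun h hh => by
    obtain ⟨g, hg, rfl⟩ := List.mem_map.1 hh
    obtain ⟨d, r, hdr⟩ := (homog g hg).2
    exact ⟨d, r, evalAt_mem_component hdr⟩
  todo_mem := fun h hh => by
    obtain ⟨g, hg, rfl⟩ := List.mem_map.1 hh
    exact hB.adjoin_eq ▸ evalAt_mem_adjoin g
  lift := ⟨{g | g ∈ G}, fun g hg => (homog g hg).1, gen, fun g hg s hs =>
    Or.inr ⟨_, List.mem_map_of_mem hg, hs, by simp⟩⟩

lemma PassInvariant.skip (H : PassInvariant 𝒜 w j B₀ B (0 :: todo)) :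
    PassInvariant 𝒜 w j B₀ B todo where
  __ := H
  todo_homogeneous := fun h hh => H.todo_homogeneous h (List.mem_cons_of_mem _ hh)
  todo_mem := fun h hh => H.todo_mem h (List.mem_cons_of_mem _ hh)
  lift := by
    obtain ⟨G, homog, gen, lift⟩ := H.lift
    refine ⟨G, homog, gen, fun g hg s hs => ?_⟩
    obtain h | ⟨h, hh, h1, h2⟩ := lift g hg s hs
    · exact Or.inl h
    · obtain rfl | hh := List.mem_cons.1 hh
      · exact Or.inl (by simpa using h2)
      · exact Or.inr ⟨h, hh, h1, h2⟩

lemma sub_evalAt_mem_level {R : Type*} [CommRing R] [Algebra k R] {v : Quasivaluation k R}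
    {B : Finset R} {p : MvPolynomial B k} {h : R} {s : ℤ} (hs : v.val h = s)
    (hp : IsOfWeight v p (v.val h)) (eq : v.init h = aeval (fun b : B => v.init b.1) p) :
    h - evalAt B p ∈ v.level (s + 1) := by
  rw [v.init_eq_toGr hs] at eq
  rw [hs] at hp
  exact (toGr_eq_aeval_init_iff _ hp).1 eq

lemma PassInvariant.subduct (hw : ∀ f, (w j).val f = ⊤ → f = 0) {h : Laurent A n}
    (H : PassInvariant 𝒜 w j B₀ B (h :: todo)) (ne : h ≠ 0) {p : MvPolynomial B k} {d : ℕ}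
    {r : Fin n → ℤ} (weight : IsOfWeight (extVal w j) p ((extVal w j).val h))
    (homog : IsMultihomogeneous 𝒜 d r p) (deg : h ∈ component 𝒜 d r)
    (eq : (extVal w j).init h = MvPolynomial.aeval (fun b : B => (extVal w j).init b.1) p) :
    PassInvariant 𝒜 w j B₀ B ((h - evalAt B p) :: todo) where
  __ := H
  todo_homogeneous := fun f hf => by
    obtain rfl | hf := List.mem_cons.1 hf
    · exact ⟨d, r, (componentSubmodule 𝒜 d r).sub_mem deg (evalAt_mem_component homog)⟩
    · exact H.todo_homogeneous f (List.mem_cons_of_mem _ hf)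
  todo_mem := fun f hf => by
    obtain rfl | hf := List.mem_cons.1 hf
    · exact Subalgebra.sub_mem _ (H.todo_mem h List.mem_cons_self)
        (H.generators.adjoin_eq ▸ evalAt_mem_adjoin p)
    · exact H.todo_mem f (List.mem_cons_of_mem _ hf)
  lift := by
    obtain ⟨G, homog, gen, lift⟩ := H.lift
    refine ⟨G, homog, gen, fun g hg s hs => ?_⟩
    obtain h' | ⟨f, hf, h1, h2⟩ := lift g hg s hs
    · exact Or.inl h'
    · obtain rfl | hf := List.mem_cons.1 hf
      · obtain ⟨s', hs'⟩ := WithTop.ne_top_iff_exists.1 (mt (eq_zero_of_val_laurent hw) ne)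
        have hss : s ≤ s' := WithTop.coe_le_coe.1 (hs' ▸ h1 : (s : WithTop ℤ) ≤ s')
        -- The pending element only gains value, and the subtracted `p(B)` has weight `v(h) ≥ s`, so
        -- it is absorbed into the weight filtration.
        refine Or.inr ⟨_, List.mem_cons_self, (extVal w j).level_anti (by omega : s ≤ s' + 1)
          (sub_evalAt_mem_level hs'.symm weight eq), ?_⟩
        rw [← sub_add]
        exact Submodule.add_mem _ h2 (evalAt_mem_weightFiltration weight h1)
      · exact Or.inr ⟨f, List.mem_cons_of_mem _ hf, h1, h2⟩

open Classical in
lemma PassInvariant.adjoin {h : Laurent A n} (H : PassInvariant 𝒜 w j B₀ B (h :: todo))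
    (new : (extVal w j).init h ∉
      Algebra.adjoin k ((extVal w j).init '' (B : Set (Laurent A n)))) :
    PassInvariant 𝒜 w j B₀ (insert h B) todo where
  generators₀ := H.generators₀
  generators :=
    { homogeneous := fun b hb => by
        obtain rfl | hb := Finset.mem_insert.1 hb
        · exact H.todo_homogeneous _ List.mem_cons_self
        · exact H.generators.homogeneous b hb
      adjoin_eq := by
        refine le_antisymm (Algebra.adjoin_le fun b hb => ?_) ?_
        · obtain rfl | hb := Finset.mem_insert.1 hb
          · exact H.todo_mem _ List.mem_cons_self
          · exact H.generators.mem hb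
        · rw [← H.generators.adjoin_eq]
          exact Algebra.adjoin_mono (Finset.coe_subset.2 (Finset.subset_insert _ _)) }
  subset := H.subset.trans (Finset.subset_insert _ _)
  -- If `B₀` is complete then so is `B = B₀`, and the initial form of `h ∈ R_j` lies in the algebra
  -- of initial forms, contrary to `new`.
  eq_of_isComplete := fun hc => by
    refine absurd (init_mem_adjoin fun s hs => ?_) new
    rw [H.eq_of_isComplete hc]
    exact hc s h (H.todo_mem h List.mem_cons_self) hs
  todo_homogeneous := fun h hh => H.todo_homogeneous h (List.mem_cons_of_mem _ hh)
  todo_mem := fun h hh => H.todo_mem h (List.mem_cons_of_mem _ hh)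
  lift := by
    obtain ⟨G, homog, gen, lift⟩ := H.lift
    have mono := weightFiltration_mono (v := extVal w j) (Finset.subset_insert h B)
    refine ⟨G, homog, gen, fun g hg s hs => ?_⟩
    obtain h' | ⟨f, hf, h1, h2⟩ := lift g hg s hs
    · exact Or.inl (mono s h')
    · obtain rfl | hf := List.mem_cons.1 hf
      · left
        rw [← sub_add_cancel (evalAt B₀ g) f]
        exact Submodule.add_mem _ (mono s h2)
          (mem_weightFiltration_of_mem (Finset.mem_insert_self _ _) h1)
      · exact Or.inr ⟨f, hf, h1, mono s h2⟩

/-- The invariant of the algorithm. -/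
def State.Invariant (𝒜 : ℕ → Submodule k A) (w : Fin n → Quasivaluation k A) : State A n → Prop
  | .stage j B => IsStageGenerators 𝒜 w j B
  | .pass j B₀ B todo => PassInvariant 𝒜 w j B₀ B todo

lemma Step.invariant [SetLike.GradedMonoid 𝒜] (hw : ∀ j f, (w j).val f = ⊤ → f = 0)
    {S S' : State A n} (h : Step 𝒜 w S S') (H : S.Invariant 𝒜 w) : S'.Invariant 𝒜 w := by
  cases h with
  | start j B G homog gen => exact PassInvariant.start H homog gen
  | skip => exact PassInvariant.skip H
  | subduct j B₀ B h todo ne p d r weight homog deg eq =>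
    exact PassInvariant.subduct (hw j) H ne weight homog deg eq
  | adjoin j B₀ B h todo new => exact PassInvariant.adjoin H new
  | again j B₀ B => exact PassInvariant.generators H
  | advance j B =>
    exact (PassInvariant.generators H).reesLift (hw j) (PassInvariant.isComplete H)

lemma invariant_of_reflTransGen [SetLike.GradedMonoid 𝒜] (hw : ∀ j f, (w j).val f = ⊤ → f = 0)
    {S S' : State A n} (h : Relation.ReflTransGen (Step 𝒜 w) S S') (H : S.Invariant 𝒜 w) :
    S'.Invariant 𝒜 w := by
  induction h with
  | refl => exact H
  | tail _ h ih => exact h.invariant hw ih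

lemma invariant_initialState [SetLike.GradedMonoid 𝒜] {B : Finset A}
    (hB : IsHomogeneousGenerators 𝒜 B) : (initialState n B).Invariant 𝒜 w := by
  classical
  refine ⟨fun b hb => ?_, le_antisymm (Algebra.adjoin_le fun b hb => ?_) fun f hf => ?_⟩
  · obtain ⟨a, ha, rfl⟩ := Finset.mem_image.1 hb
    obtain ⟨d, hd⟩ := hB.1 a ha
    exact ⟨d, 0, a, hd, rfl⟩
  · obtain ⟨a, ha, rfl⟩ := Finset.mem_image.1 hb
    exact single_mem_partialRees.2 ⟨fun i hi => absurd hi (by omega), fun ⟨i, _, h⟩ => absurd rfl h⟩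
  · have h1 : f = AddMonoidAlgebra.single 0 (f.coeff 0) := by
      refine AddMonoidAlgebra.coeff_injective (Finsupp.ext fun r => ?_)
      rw [AddMonoidAlgebra.coeff_single, Finsupp.single_apply]
      split_ifs with h
      · rw [h]
      · refine (mem_partialRees.1 hf r).2 ?_
        obtain ⟨i, hi⟩ := Function.ne_iff.1 h
        exact ⟨i, Nat.zero_le _, Ne.symm hi⟩
    let φ : A →ₐ[k] Laurent A n := AddMonoidAlgebra.singleZeroAlgHom
    have h2 : f ∈ (Algebra.adjoin k (B : Set A)).map φ := by
      rw [hB.2]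
      exact ⟨f.coeff 0, Algebra.mem_top, h1.symm⟩
    rw [AlgHom.map_adjoin] at h2
    rw [Finset.coe_image]
    exact h2

end Invariants

/-! ### Termination -/

section Termination

variable {k A : Type*} [Field k] [CommRing A] [Algebra k A] {n : ℕ}
  {𝒜 : ℕ → Submodule k A}
  {w : Fin n → Quasivaluation k A} {j : Fin n} {B₀ B : Finset (Laurent A n)}

/-- Passes terminate if their continuations do. -/
lemma terminates_pass [GradedAlgebra 𝒜] [∀ d, FiniteDimensional k (𝒜 d)]
    (hw : ∀ f, (w j).val f = ⊤ → f = 0)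
    (hw' : ∀ f (d : ℕ), (w j).val f ≤ (w j).val (DirectSum.decompose 𝒜 f d : A))
    (advance : ∀ B, IsStageGenerators 𝒜 w (j + 1) B → Terminates 𝒜 w (.stage (j + 1) B))
    (again : ∀ B, PassInvariant 𝒜 w j B₀ B [] → B ≠ B₀ → Terminates 𝒜 w (.stage j B))
    (todo : List (Laurent A n)) (B : Finset (Laurent A n))
    (H : PassInvariant 𝒜 w j B₀ B todo) : Terminates 𝒜 w (.pass j B₀ B todo) := by
  classical
  induction todo generalizing B with
  | nil =>
    refine Terminates.step _ ?_ fun S' hS' => ?_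
    · by_cases h : B = B₀
      · subst h
        exact ⟨_, Step.advance j B⟩
      · exact ⟨_, Step.again j B₀ B h⟩
    · cases hS' with
      | again _ _ _ h => exact again B H h
      | advance => exact advance _ (H.generators.reesLift hw H.isComplete)
  | cons h todo ih =>
    obtain ⟨d, r, hdr⟩ := H.todo_homogeneous h List.mem_cons_self
    -- Well-founded induction on `S = G_{v(h)} ∩ A_d` inside the finite-dimensional space `A_d`. If
    -- `v(h) = ∞`, nothing is required of `S`, and `⊥` will do.
    have key : ∀ (S : Submodule k (𝒜 d)) (h : Laurent A n), h ∈ component 𝒜 d r →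
        (∀ s : ℤ, (extVal w j).val h = s → ((w j).level s).comap (𝒜 d).subtype = S) →
        PassInvariant 𝒜 w j B₀ B (h :: todo) → Terminates 𝒜 w (.pass j B₀ B (h :: todo)) := by
      intro S
      induction S using WellFoundedLT.induction with
      | ind S ihS =>
      intro h hdr hS H
      have adjoin_step : (extVal w j).init h ∉ Algebra.adjoin k
          ((extVal w j).init '' (B : Set (Laurent A n))) →
          Terminates 𝒜 w (.pass j B₀ (insert h B) todo) := fun new => ih _ (H.adjoin new)
      by_cases h0 : h = 0
      · subst h0
        refine Terminates.step _ ⟨_, Step.skip j B₀ B todo⟩ fun S' hS' => ?_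
        cases hS' with
        | skip => exact ih B H.skip
        | subduct _ _ _ _ _ ne => exact absurd rfl ne
        | adjoin _ _ _ _ _ new => convert adjoin_step new
      · have ht : (extVal w j).val h ≠ ⊤ := mt (eq_zero_of_val_laurent hw) h0
        refine Terminates.step _ ?_ fun S' hS' => ?_
        · by_cases hi : (extVal w j).init h ∈ Algebra.adjoin k
            ((extVal w j).init '' (B : Set (Laurent A n)))
          · obtain ⟨p, h1, h2, h3⟩ :=
              exists_homogeneous_subduction H.generators.homogeneous hw' hdr ht hi
            exact ⟨_, Step.subduct j B₀ B h todo h0 p d r h1 h2 hdr h3⟩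
          · exact ⟨_, Step.adjoin j B₀ B h todo hi⟩
        · cases hS' with
          | skip => exact absurd rfl h0
          | adjoin _ _ _ _ _ new => convert adjoin_step new
          | subduct _ _ _ _ _ ne p d' r' weight homog deg eq =>
            have H' := H.subduct hw ne weight homog deg eq
            -- The degree chosen by the subduction is that of `h`, so the process stays inside the
            -- same `A_d`.
            obtain ⟨rfl, rfl⟩ := Prod.ext_iff.1 (component_unique h0 hdr deg)
            obtain ⟨s, hs⟩ := WithTop.ne_top_iff_exists.1 ht
            have hdr' : h - evalAt B p ∈ component 𝒜 d r :=
              (componentSubmodule 𝒜 d r).sub_mem hdr (evalAt_mem_component homog)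
            have hlev := sub_evalAt_mem_level hs.symm weight eq
            by_cases ht' : (extVal w j).val (h - evalAt B p) = ⊤
            · have h0' := eq_zero_of_val_laurent hw ht'
              rw [h0'] at H' ⊢
              refine Terminates.step _ ⟨_, Step.skip j B₀ B todo⟩ fun S' hS' => ?_
              cases hS' with
              | skip => exact ih B H'.skip
              | subduct _ _ _ _ _ ne => exact absurd rfl ne
              | adjoin _ _ _ _ _ new => convert ih _ (H'.adjoin new)
            · obtain ⟨s', hs'⟩ := WithTop.ne_top_iff_exists.1 ht'
              have hss : s + 1 ≤ s' := WithTop.coe_le_coe.1 (hs' ▸ hlev)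
              refine ihS (((w j).level s').comap (𝒜 d).subtype) ?_ _ hdr'
                (fun s'' hs'' => ?_) H'
              -- The inclusion is strict because the coefficient of `h` has value exactly `s < s'`.
              · rw [← hS s hs.symm]
                refine lt_of_le_of_ne (Submodule.comap_mono ((w j).level_anti (by omega)))
                  fun heq => ?_
                obtain ⟨a, ha, rfl⟩ := hdr
                have h1 : (⟨a, ha⟩ : 𝒜 d) ∈ ((w j).level s).comap (𝒜 d).subtype := by
                  rw [val_laurent_single] at hs
                  exact hs.le
                rw [← heq] at h1
                have h2 : (s' : WithTop ℤ) ≤ (w j).val a := h1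
                rw [val_laurent_single] at hs
                rw [← hs, WithTop.coe_le_coe] at h2
                omega
              · rw [← hs', WithTop.coe_inj] at hs''
                rw [hs'']
    by_cases ht : (extVal w j).val h = ⊤
    · exact key ⊥ h hdr (fun s hs => by simp [ht] at hs) H
    · obtain ⟨s, hs⟩ := WithTop.ne_top_iff_exists.1 ht
      refine key (((w j).level s).comap (𝒜 d).subtype) h hdr (fun s' hs' => ?_) H
      rw [← hs, WithTop.coe_inj] at hs'
      rw [hs']

lemma weightSubalgebra_mono {B B' : Finset (Laurent A n)} (h : B ⊆ B') :
    weightSubalgebra w j B ≤ weightSubalgebra w j B' := fun _ hf r =>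
  weightFiltration_mono h _ (hf r)

/-- In an infinite sequence of passes some generating set is complete, if `R_{j+1}` is finitely
generated. -/
lemma exists_isComplete_of_seq (fg : (partialRees w (j + 1)).FG) (B : ℕ → Finset (Laurent A n))
    (H : ∀ i, PassInvariant 𝒜 w j (B i) (B (i + 1)) []) : ∃ i, IsComplete w j (B i) := by
  have mono : Monotone B := monotone_nat_of_le_succ fun i => (H i).subset
  have union : ∀ (s : ℤ), ∀ f ∈ partialRees w j, f ∈ (extVal w j).level s →
      ∃ i, f ∈ weightFiltration (extVal w j) (B i) s := by
    intro s f hf hs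
    obtain ⟨r, hr⟩ := exists_mem_weightFiltration (v := extVal w j)
      ((H 0).generators₀.adjoin_eq ▸ hf)
    -- Each pass raises the weight of `f` by at least one, so `s - r` passes suffice.
    have key : ∀ e : ℕ, r + e ≤ s → f ∈ weightFiltration (extVal w j) (B e) (r + e) := by
      intro e
      induction e with
      | zero => intro _; simpa using hr
      | succ e ih =>
        intro he
        push_cast at he ⊢
        rw [← add_assoc] at he ⊢
        exact (H e).mem_weightFiltration_succ (ih (by omega)) ((extVal w j).level_anti he hs)
    by_cases hrs : r ≤ s
    · obtain ⟨e, he⟩ := Int.eq_ofNat_of_zero_le (sub_nonneg.2 hrs)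
      have : s = r + e := by omega
      exact ⟨e, this ▸ key e this.ge⟩
    · exact ⟨0, weightFiltration_anti (by omega) hr⟩
  have dir : Directed (· ≤ ·) fun i => weightSubalgebra w j (B i) :=
    Monotone.directed_le fun _ _ h => weightSubalgebra_mono (mono h)
  have le : partialRees w (j + 1) ≤ ⨆ i, weightSubalgebra w j (B i) := by
    intro f hf
    refine mem_of_single_mem (P := (⨆ i, weightSubalgebra w j (B i)).toSubmodule.toAddSubmonoid)
      fun r => ?_
    obtain ⟨h1, h2⟩ := single_update_mem_partialRees (single_coeff_mem_partialRees hf r)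
    obtain ⟨i, hi⟩ := union _ _ h1 h2
    exact le_iSup (fun i => weightSubalgebra w j (B i)) i (single_mem_gradedSubalgebra.2 hi)
  obtain ⟨T, hT⟩ := fg
  have hT' : (T : Set (Laurent A n)) ⊆ ⋃ i, (weightSubalgebra w j (B i) : Set (Laurent A n)) := by
    rw [← Subalgebra.coe_iSup_of_directed dir]
    exact fun f hf => le (hT ▸ Algebra.subset_adjoin hf)
  -- The subalgebras form a chain, so one of them contains the finitely many generators of
  -- `R_{j+1}`.
  obtain ⟨i, hi⟩ := Directed.exists_mem_subset_of_finset_subset_biUnion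
    (f := fun i => (weightSubalgebra w j (B i) : Set (Laurent A n))) dir hT'
  exact ⟨i, partialRees_le_weightSubalgebra_iff.1 (hT ▸ Algebra.adjoin_le hi)⟩

/-- Passes are finite, so a stage that fails to terminate has a pass ending in a different
generating set for which the stage fails again. Iterating this choice gives an infinite sequence of
passes; one of its sets is complete, and the pass from that set could not have changed it. -/
lemma terminates_stage [GradedAlgebra 𝒜] [∀ d, FiniteDimensional k (𝒜 d)]
    (hw : ∀ f, (w j).val f = ⊤ → f = 0)
    (hw' : ∀ f (d : ℕ), (w j).val f ≤ (w j).val (DirectSum.decompose 𝒜 f d : A))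
    (fg : (partialRees w (j + 1)).FG)
    (advance : ∀ B, IsStageGenerators 𝒜 w (j + 1) B → Terminates 𝒜 w (.stage (j + 1) B))
    (B : Finset (Laurent A n)) (hB : IsStageGenerators 𝒜 w j B) :
    Terminates 𝒜 w (.stage j B) := by
  by_contra hnot
  have next : ∀ B : {B // IsStageGenerators 𝒜 w j B ∧ ¬ Terminates 𝒜 w (.stage j B)},
      ∃ B' : {B // IsStageGenerators 𝒜 w j B ∧ ¬ Terminates 𝒜 w (.stage j B)},
        PassInvariant 𝒜 w j B.1 B'.1 [] ∧ B'.1 ≠ B.1 := by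
    rintro ⟨B, hB, hnot⟩
    by_contra hcon
    push Not at hcon
    apply hnot
    refine Terminates.step _ ?_ fun S' hS' => ?_
    · obtain ⟨G, h1, h2⟩ := exists_homogeneous_generators hB.homogeneous hw'
      exact ⟨_, Step.start j B G h1 h2⟩
    · generalize hS : State.stage j.1 B = S at hS'
      cases hS' with
      | start j' B' G homog gen =>
        obtain ⟨h1, rfl⟩ := State.stage.inj hS
        obtain rfl := Fin.ext h1
        refine terminates_pass hw hw' advance (fun B' H ne => ?_) _ _ (.start hB homog gen)
        by_contra hB'
        exact ne (hcon ⟨B', H.generators, hB'⟩ H)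
      | _ => cases hS
  choose f hf using next
  let Bs : ℕ → {B // IsStageGenerators 𝒜 w j B ∧ ¬ Terminates 𝒜 w (.stage j B)} :=
    fun i => f^[i] ⟨B, hB, hnot⟩
  have hBs : ∀ i, Bs (i + 1) = f (Bs i) := fun i => Function.iterate_succ_apply' f i _
  obtain ⟨i, hi⟩ := exists_isComplete_of_seq (𝒜 := 𝒜) fg (fun i => (Bs i).1)
    (fun i => by rw [hBs]; exact (hf _).1)
  exact (hf (Bs i)).2 ((hf (Bs i)).1.eq_of_isComplete hi)

/-- The exponents with the coordinates from `j` on deleted. -/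
def truncateExponents (n j : ℕ) : (Fin n → ℤ) →+ (Fin n → ℤ) where
  toFun r i := if i.1 < j then r i else 0
  map_zero' := by ext; simp
  map_add' r s := by ext i; by_cases h : i.1 < j <;> simp [h]

/-- Setting `t_i = 1` for `i ≥ j` maps `R_n` onto `R_j`: surjectivity holds because every element of
`A` lies in some level of each later quasivaluation. -/
lemma partialRees_fg (fg : (partialRees w n).FG) (j : ℕ) :
    (partialRees w j).FG := by
  have : partialRees w j = (partialRees w n).map
      (AddMonoidAlgebra.mapDomainAlgHom k A (truncateExponents n j)) := by
    have hsingle : ∀ (r : Fin n → ℤ) (a : A),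
        AddMonoidAlgebra.mapDomainAlgHom k A (truncateExponents n j)
          (AddMonoidAlgebra.single r a) =
        AddMonoidAlgebra.single (truncateExponents n j r) a := fun r a =>
      AddMonoidAlgebra.mapDomain_single
    apply le_antisymm
    · intro f hf
      refine mem_of_single_mem (P := ((partialRees w n).map
        (AddMonoidAlgebra.mapDomainAlgHom k A
          (truncateExponents n j))).toSubmodule.toAddSubmonoid) fun r => ?_
      have h := mem_partialRees.1 hf r
      by_cases h0 : f.coeff r = 0
      · rw [h0, AddMonoidAlgebra.single_zero]; exact zero_mem _
      -- The preimage carries as its later exponents the values of the coefficient, with `0` in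
      -- place of `∞`.
      refine ⟨AddMonoidAlgebra.single
        (fun i => if i.1 < j then r i else ((w i).val (f.coeff r)).untopD 0) (f.coeff r), ?_, ?_⟩
      · refine single_mem_partialRees.2 ⟨fun i _ => ?_, fun ⟨i, hi, _⟩ => absurd hi (by omega)⟩
        split_ifs with hi
        · exact h.1 i hi
        · rw [Quasivaluation.mem_level]
          cases (w i).val (f.coeff r) <;> simp
      · refine (hsingle _ _).trans ?_
        congr 1
        ext i
        change (if i.1 < j then (if i.1 < j then r i else _) else 0) = r i
        split_ifs with hi
        · rfl
        · by_contra hr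
          exact h0 (h.2 ⟨i, by omega, Ne.symm hr⟩)
    · rintro _ ⟨f, hf, rfl⟩
      have hf' := hf
      rw [← AddMonoidAlgebra.sum_coeff_single f]
      change AddMonoidAlgebra.mapDomainAlgHom k A (truncateExponents n j)
        (f.coeff.sum AddMonoidAlgebra.single) ∈ _
      rw [Finsupp.sum, map_sum]
      refine Subalgebra.sum_mem _ fun r _ => ?_
      rw [hsingle, single_mem_partialRees]
      refine ⟨fun i hi => ?_, ?_⟩
      · have := (mem_partialRees.1 hf r).1 i i.2
        simpa [truncateExponents, hi] using this
      · rintro ⟨i, hi, hr⟩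
        exact absurd (if_neg (by omega)) hr
  rw [this]
  exact fg.map _

/-- Induction on the number `e` of rays still to be treated, since termination of a stage
presupposes that of the next. -/
lemma terminates_of_fg [GradedAlgebra 𝒜] [∀ d, FiniteDimensional k (𝒜 d)]
    (hw : ∀ j f, (w j).val f = ⊤ → f = 0)
    (hw' : ∀ j f (d : ℕ), (w j).val f ≤ (w j).val (DirectSum.decompose 𝒜 f d : A))
    (fg : (partialRees w n).FG) (e j : ℕ) (hj : j + e = n) (B : Finset (Laurent A n))
    (hB : IsStageGenerators 𝒜 w j B) : Terminates 𝒜 w (.stage j B) := by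
  induction e generalizing j B with
  | zero =>
    obtain rfl : j = n := by omega
    exact Terminates.output B
  | succ e ih =>
    have hjn : j < n := by omega
    exact terminates_stage (j := ⟨j, hjn⟩) (hw _) (hw' _) (partialRees_fg fg _)
      (fun B hB => ih (j + 1) (by omega) B hB) B hB

lemma Terminates.canTerminate {S : State A n} (h : Terminates 𝒜 w S) : CanTerminate 𝒜 w S := by
  induction h with
  | output B => exact ⟨B, .refl⟩
  | step S progress _ ih =>
    obtain ⟨S', hS'⟩ := progress
    obtain ⟨B, hB⟩ := ih S' hS'
    exact ⟨B, hB.head hS'⟩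

lemma exists_stageGenerators_of_canTerminate [GradedAlgebra 𝒜]
    (hw : ∀ j f, (w j).val f = ⊤ → f = 0) {B : Finset A}
    (hB : IsHomogeneousGenerators 𝒜 B) (h : CanTerminate 𝒜 w (initialState n B)) :
    ∃ B', IsStageGenerators 𝒜 w n B' := by
  obtain ⟨B', h⟩ := h
  exact ⟨B', invariant_of_reflTransGen hw h (invariant_initialState hB)⟩

lemma IsStageGenerators.fg {j : ℕ} {B : Finset (Laurent A n)}
    (hB : IsStageGenerators 𝒜 w j B) : (partialRees w j).FG := ⟨B, hB.adjoin_eq⟩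

end Termination

/-! ### Piecewise linear functions on a smooth fan -/

namespace SmoothFan

variable {N : Type*} [AddCommGroup N] {F : SmoothFan N} {n : ℕ} (ρ : Fin n ≃ F.Ray)

/-- The ray generated by an element of a cone. -/
def rayOfMem {s : Finset N} (hs : s ∈ F.cones) {y : N} (hy : y ∈ s) : F.Ray :=
  ⟨y, F.face s hs {y} (Finset.singleton_subset_iff.2 hy)⟩

/-- A piecewise linear function is determined by its values on the rays. -/
lemma PL_ext {ψ φ : F.PL} (h : ∀ r : F.Ray, ψ.1 r.point = φ.1 r.point) : ψ = φ := by
  refine Subtype.ext (funext fun x => ?_)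
  obtain ⟨s, hs, hx⟩ := x.2
  obtain ⟨m, hm⟩ := ψ.2 s hs
  obtain ⟨m', hm'⟩ := φ.2 s hs
  rw [hm _ hx, hm' _ hx]
  have : Set.EqOn (m : N →+ ℤ) (m' : N →+ ℤ) s := fun y hy => by
    have h1 := hm (rayOfMem hs hy).point (AddSubmonoid.subset_closure hy)
    have h2 := hm' (rayOfMem hs hy).point (AddSubmonoid.subset_closure hy)
    exact h1.symm.trans ((h _).trans h2)
  exact AddMonoidHom.eqOn_closureM this hx

/-- Smoothness enters here: the ray generators of a cone are part of a lattice basis, so their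
values can be prescribed. -/
lemma exists_linear {s : Finset N} (hs : s ∈ F.cones) (c : N → ℤ) :
    ∃ m : N →ₗ[ℤ] ℤ, ∀ y ∈ s, m y = c y := by
  obtain ⟨b, hb⟩ := F.smooth s hs
  refine ⟨b.constr ℤ fun i => c (b i), fun y hy => ?_⟩
  obtain ⟨i, rfl⟩ := hb hy
  exact b.constr_basis ℤ _ i

/-- There is a piecewise linear function with given values on the rays. -/
lemma exists_PL (c : F.Ray → ℤ) : ∃ ψ : F.PL, ∀ r : F.Ray, ψ.1 r.point = c r := by
  classical
  let c' : N → ℤ := fun y => if h : ({y} : Finset N) ∈ F.cones then c ⟨y, h⟩ else 0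
  choose m hm using fun (s : Finset N) (hs : s ∈ F.cones) => exists_linear hs c'
  have compat : ∀ s (hs : s ∈ F.cones) t (ht : t ∈ F.cones) (x : N),
      x ∈ AddSubmonoid.closure (s : Set N) → x ∈ AddSubmonoid.closure (t : Set N) →
      m s hs x = m t ht x := by
    intro s hs t ht x hxs hxt
    -- Two cones meet in the cone over their common rays, where both linear forms take the
    -- prescribed values.
    have hx : x ∈ AddSubmonoid.closure ((s : Set N) ∩ t) := F.inter s hs t ht ▸ ⟨hxs, hxt⟩
    have : Set.EqOn (m s hs : N →+ ℤ) (m t ht : N →+ ℤ) ((s : Set N) ∩ t) := fun y hy =>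
      (hm s hs y hy.1).trans (hm t ht y hy.2).symm
    exact AddMonoidHom.eqOn_closureM this hx
  refine ⟨⟨fun x => m x.2.choose x.2.choose_spec.1 x.1, fun s hs => ⟨m s hs, fun x hx =>
    compat _ _ _ _ _ x.2.choose_spec.2 hx⟩⟩, fun r => ?_⟩
  have h1 : r.point.1 ∈ AddSubmonoid.closure (({r.1} : Finset N) : Set N) :=
    AddSubmonoid.subset_closure (by simp [Ray.point])
  refine (compat _ _ _ r.2 _ r.point.2.choose_spec.2 h1).trans ?_
  refine (hm _ _ r.1 (by simp)).trans ?_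
  exact dif_pos r.2

/-- Piecewise linear functions correspond to their values on the rays. -/
def equivPL : F.PL ≃+ (Fin n → ℤ) :=
  AddEquiv.ofBijective
    ({ toFun := fun ψ i => ψ.1 (ρ i).point
       map_zero' := rfl
       map_add' := fun _ _ => rfl } : F.PL →+ (Fin n → ℤ))
    ⟨fun ψ φ h => PL_ext fun r => by simpa using congrFun h (ρ.symm r), fun c => by
      obtain ⟨ψ, hψ⟩ := exists_PL fun r => c (ρ.symm r)
      exact ⟨ψ, funext fun i => by simp [hψ]⟩⟩

lemma equivPL_apply (ψ : F.PL) (i : Fin n) : equivPL ρ ψ i = ψ.1 (ρ i).point := rfl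

/-! ### Klyachko spaces and the total section ring -/

section Sections

variable {k A : Type*} [Field k] [CommRing A] [Algebra k A] {v : F.Point → Quasivaluation k A}

lemma mem_sections {ψ : F.PL} {f : A} :
    f ∈ F.sections v ψ ↔ ∀ x : F.Point, f ∈ (v x).level (ψ.1 x) := by
  rw [sections, Submodule.mem_iInf]

/-- In an adapted basis, membership at `x` says `l x ≤ m i x` for all `i` in the support of `f`.
These inequalities are linear on the cone, so they need only be checked on its rays. -/
lemma mem_sections_iff
    (adapted : ∀ s ∈ F.cones, F.HasLinearAdaptedBasis (fun x => (v x).toPrevaluation) s)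
    {ψ : F.PL} {f : A} :
    f ∈ F.sections v ψ ↔ ∀ i : Fin n, f ∈ (v (ρ i).point).level (ψ.1 (ρ i).point) := by
  rw [mem_sections]
  refine ⟨fun h i => h _, fun h x => ?_⟩
  obtain ⟨s, hs, hx⟩ := x.2
  obtain ⟨κ, b, m, hb⟩ := adapted s hs
  obtain ⟨l, hl⟩ := ψ.2 s hs
  have key : ∀ (x : F.Point), x.1 ∈ AddSubmonoid.closure (s : Set N) → (f ∈ (v x).level (ψ.1 x) ↔
      ∀ i ∈ (b.repr f).support, l x.1 ≤ m i x.1) := by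
    intro x hx
    rw [Quasivaluation.mem_level]
    change _ ≤ (v x).toPrevaluation.val f ↔ _
    rw [hb x hx, Finset.le_inf_iff, hl x hx]
    simp
  rw [key _ hx]
  intro i hi
  generalize x.1 = y at hx
  induction hx using AddSubmonoid.closure_induction with
  | mem y hy =>
    have h1 := h (ρ.symm (rayOfMem hs hy))
    rw [Equiv.apply_symm_apply, key _ (AddSubmonoid.subset_closure hy)] at h1
    exact h1 i hi
  | zero => simp
  | add y z _ _ hy hz => rw [map_add, map_add]; exact add_le_add hy hz

lemma eq_zero_of_val
    (adapted : ∀ s ∈ F.cones, F.HasLinearAdaptedBasis (fun x => (v x).toPrevaluation) s)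
    (x : F.Point) {f : A} (hf : (v x).val f = ⊤) : f = 0 := by
  obtain ⟨s, hs, hx⟩ := x.2
  obtain ⟨κ, b, m, hb⟩ := adapted s hs
  have h1 : (b.repr f).support.inf (fun i => ((m i x.1 : ℤ) : WithTop ℤ)) = ⊤ :=
    (hb x hx f).symm.trans hf
  rw [Finset.inf_eq_top_iff] at h1
  rw [← b.repr.map_eq_zero_iff, ← Finsupp.support_eq_empty, Finset.eq_empty_iff_forall_notMem]
  exact fun i hi => WithTop.coe_ne_top (h1 i hi)

/-- The total section ring is the multi-Rees algebra of the rays. -/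
lemma map_totalSections
    (adapted : ∀ s ∈ F.cones, F.HasLinearAdaptedBasis (fun x => (v x).toPrevaluation) s) :
    (F.totalSections v).map (AddMonoidAlgebra.domCongr k A (equivPL ρ)).toAlgHom =
      partialRees (fun i => v (ρ i).point) n := by
  have key : ∀ (ψ : F.PL) (a : A), a ∈ F.sections v ψ ↔
      AddMonoidAlgebra.single (equivPL ρ ψ) a ∈ partialRees (fun i => v (ρ i).point) n := by
    intro ψ a
    rw [mem_sections_iff ρ adapted, single_mem_partialRees]
    exact ⟨fun h => ⟨fun i _ => h i, fun ⟨i, hi, _⟩ => absurd hi (by omega)⟩,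
      fun h i => h.1 i i.2⟩
  apply le_antisymm
  · rintro _ ⟨f, hf, rfl⟩
    rw [← AddMonoidAlgebra.sum_coeff_single f]
    change AddMonoidAlgebra.domCongr k A (equivPL ρ) (f.coeff.sum AddMonoidAlgebra.single) ∈ _
    rw [Finsupp.sum, map_sum]
    refine Subalgebra.sum_mem _ fun ψ _ => ?_
    rw [AddMonoidAlgebra.domCongr_single]
    exact (key ψ _).1 (hf ψ)
  · intro f hf
    refine mem_of_single_mem (P := ((F.totalSections v).map (AddMonoidAlgebra.domCongr k A
      (equivPL ρ)).toAlgHom).toSubmodule.toAddSubmonoid) fun r => ?_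
    refine ⟨AddMonoidAlgebra.single ((equivPL ρ).symm r) (f.coeff r),
      single_mem_gradedSubalgebra.2 ?_, ?_⟩
    · rw [key, AddEquiv.apply_symm_apply]
      exact single_coeff_mem_partialRees hf r
    · refine (AddMonoidAlgebra.domCongr_single (R := k) ..).trans ?_
      rw [AddEquiv.apply_symm_apply]

lemma fg_totalSections_iff
    (adapted : ∀ s ∈ F.cones, F.HasLinearAdaptedBasis (fun x => (v x).toPrevaluation) s) :
    (F.totalSections v).FG ↔ (partialRees (fun i => v (ρ i).point) n).FG := by
  rw [← map_totalSections ρ adapted]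
  exact ⟨fun h => h.map _, fun h => Subalgebra.fg_of_fg_map _ _
    (AddMonoidAlgebra.domCongr k A (equivPL ρ)).injective h⟩

lemma toFiber_single (ψ : F.PL) (a : A) : F.toFiber (AddMonoidAlgebra.single ψ a) = a := by
  rw [toFiber, AddMonoidAlgebra.coeff_single, Finsupp.sum_single_index rfl]

lemma exists_finite_strongKhovanskiiBasis
    (adapted : ∀ s ∈ F.cones, F.HasLinearAdaptedBasis (fun x => (v x).toPrevaluation) s)
    {𝒜 : ℕ → Submodule k A} {B : Finset (Laurent A n)}
    (hB : IsStageGenerators 𝒜 (fun i => v (ρ i).point) n B) :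
    ∃ C : Set A, C.Finite ∧ F.IsStrongKhovanskiiBasis v C := by
  classical
  let e := AddMonoidAlgebra.domCongr k A (equivPL ρ)
  refine ⟨F.toFiber '' (e.symm '' (B : Set (Laurent A n))), (B.finite_toSet.image _).image _,
    e.symm '' (B : Set (Laurent A n)), ?_, ?_, rfl⟩
  · rintro _ ⟨b, hb, rfl⟩
    obtain ⟨d, r, a, _, rfl⟩ := hB.homogeneous b hb
    exact ⟨(equivPL ρ).symm r, a, AddMonoidAlgebra.domCongr_single ..⟩
  · have h1 := hB.adjoin_eq
    rw [← map_totalSections ρ adapted] at h1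
    refine Subalgebra.map_injective (f := e.toAlgHom) e.injective ?_
    rw [← h1, AlgHom.map_adjoin]
    congr 1
    rw [Set.image_image]
    exact (Set.image_congr fun b _ => e.apply_symm_apply b).trans (Set.image_id' _)

open Classical in
-- The homogeneous generators may be infinite in number although their image `C` is finite. Each of
-- them is obtained from the maximal shift of some `a ∈ C` by multiplying with powers of the
-- `t_i⁻¹`, so these shifts and the `t_i⁻¹` suffice.
lemma fg_of_strongKhovanskiiBasis
    (adapted : ∀ s ∈ F.cones, F.HasLinearAdaptedBasis (fun x => (v x).toPrevaluation) s)
    {C : Set A} (hC : C.Finite) (h : F.IsStrongKhovanskiiBasis v C) :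
    (partialRees (fun i => v (ρ i).point) n).FG := by
  obtain ⟨S, hS, hS', rfl⟩ := h
  let e := AddMonoidAlgebra.domCongr k A (equivPL ρ)
  let top : A → Laurent A n := fun a =>
    AddMonoidAlgebra.single (fun i => ((v (ρ i).point).val a).untopD 0) a
  let T : Set (Laurent A n) := top '' (F.toFiber '' S) ∪
    Set.range fun i : Fin n => varPow A i (-1)
  have hT : T.Finite := (hC.image _).union (Set.finite_range _)
  refine Subalgebra.fg_def.2 ⟨T, hT, le_antisymm (Algebra.adjoin_le ?_) ?_⟩
  · rintro _ (⟨a, _, rfl⟩ | ⟨j, rfl⟩)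
    · refine single_mem_partialRees.2 ⟨fun i _ => ?_, fun ⟨i, hi, _⟩ => absurd hi (by omega)⟩
      rw [Quasivaluation.mem_level]
      cases (v (ρ i).point).val a <;> simp
    · refine single_mem_partialRees.2 ⟨fun i _ => ?_, fun ⟨i, hi, _⟩ => absurd hi (by omega)⟩
      refine Quasivaluation.level_anti _ ?_ (Quasivaluation.one_mem_level _)
      by_cases h : i = j
      · subst h; simp
      · simp [h]
  · rw [← map_totalSections ρ adapted, ← hS', AlgHom.map_adjoin]
    refine Algebra.adjoin_le ?_
    rintro _ ⟨f, hf, rfl⟩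
    have hf' : f ∈ F.totalSections v := hS' ▸ Algebra.subset_adjoin hf
    obtain ⟨ψ, a, rfl⟩ := hS f hf
    have ha : top a ∈ T := Or.inl ⟨a, ⟨_, hf, toFiber_single ψ a⟩, rfl⟩
    have hψ : ∀ i, a ∈ (v (ρ i).point).level (ψ.1 (ρ i).point) :=
      (mem_sections_iff ρ adapted).1 (single_mem_gradedSubalgebra.1 hf')
    have h1 : e (AddMonoidAlgebra.single ψ a) = AddMonoidAlgebra.single (equivPL ρ ψ) a :=
      AddMonoidAlgebra.domCongr_single ..
    change e (AddMonoidAlgebra.single ψ a) ∈ Algebra.adjoin k T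
    rw [h1]
    by_cases h0 : a = 0
    · rw [h0, AddMonoidAlgebra.single_zero]; exact zero_mem _
    -- The exponent `ψ(ρ_i)` is at most the value of `a`, which is finite as `a ≠ 0`; the difference
    -- counts the factors `t_i⁻¹`.
    have hle : ∀ i, ∃ e : ℕ, equivPL ρ ψ i = ((v (ρ i).point).val a).untopD 0 + -(e : ℤ) := by
      intro i
      have h2 := hψ i
      rw [Quasivaluation.mem_level] at h2
      have h3 : (v (ρ i).point).val a ≠ ⊤ := mt (eq_zero_of_val adapted _) h0
      obtain ⟨s, hs⟩ := WithTop.ne_top_iff_exists.1 h3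
      rw [← hs, WithTop.coe_le_coe] at h2
      obtain ⟨e, he⟩ := Int.eq_ofNat_of_zero_le (sub_nonneg.2 h2)
      refine ⟨e, ?_⟩
      rw [← hs, WithTop.untopD_coe, equivPL_apply]
      omega
    choose ε hε using hle
    have h2 : AddMonoidAlgebra.single (equivPL ρ ψ) a = top a * ∏ i, varPow A i (-1) ^ ε i := by
      have h3 : ∀ t : Finset (Fin n), ∏ i ∈ t, varPow A i (-1) ^ ε i =
          AddMonoidAlgebra.single (∑ i ∈ t, Pi.single i (-(ε i : ℤ))) 1 := by
        intro t
        induction t using Finset.induction_on with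
        | empty => simp [AddMonoidAlgebra.one_def]
        | insert i t hi ih =>
          rw [Finset.prod_insert hi, Finset.sum_insert hi, ih, ← varPow_neg, varPow,
            AddMonoidAlgebra.single_mul_single, mul_one]
      rw [h3, AddMonoidAlgebra.single_mul_single, mul_one]
      congr 1
      ext i
      rw [Pi.add_apply, Finset.univ_sum_single (fun i => -(ε i : ℤ))]
      exact hε i
    rw [h2]
    refine mul_mem (Algebra.subset_adjoin ha) (Subalgebra.prod_mem _ fun i _ => pow_mem ?_ _)
    exact Algebra.subset_adjoin (Or.inr ⟨i, rfl⟩)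

end Sections

end SmoothFan

/-! ### The symmetric algebra of a toric vector bundle -/

section Symmetric

/-- The value `∞` is given only to elements of every `G s`: by exhaustiveness, if `f` misses some
step, then the set of its steps is nonempty and bounded above, and so has a maximum. -/
lemma Quasivaluation.mem_level_ofFiltration {k A : Type*} [Field k] [CommRing A] [Algebra k A]
    {G : ℤ → Submodule k A} (anti : Antitone G) (exh : ∀ f, ∃ r, f ∈ G r)
    (mul : ∀ r s f g, f ∈ G r → g ∈ G s → f * g ∈ G (r + s)) (one : (1 : A) ∈ G 0)
    (one' : (1 : A) ∉ G 1) (f : A) (s : ℤ) :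
    f ∈ (ofFiltration G anti exh mul one one').level s ↔ f ∈ G s := by
  classical
  have hval : (ofFiltration G anti exh mul one one').val f =
      if h : ∃ r, IsGreatest {r : ℤ | f ∈ G r} r then ((Classical.choose h : ℤ) : WithTop ℤ)
      else ⊤ := by
    unfold ofFiltration
    congr
  rw [mem_level, hval]
  by_cases h : ∃ r, IsGreatest {r : ℤ | f ∈ G r} r
  · have hr := Classical.choose_spec h
    rw [dif_pos h, WithTop.coe_le_coe]
    exact ⟨fun hs => anti hs hr.1, fun hs => hr.2 hs⟩
  · simp only [dif_neg h, le_top, true_iff]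
    by_contra hs
    obtain ⟨r, hr⟩ := exh f
    have hb : ∀ z : ℤ, f ∈ G z → z ≤ s := fun z hz => by
      by_contra hlt
      exact hs (anti (not_le.mp hlt).le hz)
    obtain ⟨ub, h1, h2⟩ := Int.exists_greatest_of_bdd (P := fun z => f ∈ G z) ⟨s, hb⟩ ⟨r, hr⟩
    exact h ⟨ub, h1, fun z hz => h2 z hz⟩

variable {k : Type*} [Field k] {E : Type*} [AddCommGroup E] [Module k E]

lemma mem_level_symVal {v : Prevaluation k E} {s : ℤ} {f : SymmetricAlgebra k E} :
    f ∈ (symVal v).level s ↔ f ∈ symFiltration v s :=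
  Quasivaluation.mem_level_ofFiltration ..

instance : SetLike.GradedMonoid (symGrading k E) := Submodule.nat_power_gradedMonoid _

lemma ι_mem_symGrading (e : E) : SymmetricAlgebra.ι k E e ∈ symGrading k E 1 := by
  rw [symGrading, pow_one]; exact LinearMap.mem_range_self _ e

/-- The inclusion of `E` into the direct sum of the `Symᵈ(E)`. -/
def gradedι (k E : Type*) [Field k] [AddCommGroup E] [Module k E] :
    E →ₗ[k] DirectSum ℕ fun i => symGrading k E i :=
  DirectSum.lof k ℕ (fun i => symGrading k E i) 1 ∘ₗ
    (SymmetricAlgebra.ι k E).codRestrict _ ι_mem_symGrading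

lemma gradedι_apply (e : E) : gradedι k E e =
    DirectSum.of (fun i => symGrading k E i) 1 ⟨SymmetricAlgebra.ι k E e, ι_mem_symGrading e⟩ :=
  rfl

instance : GradedAlgebra (symGrading k E) :=
  GradedAlgebra.ofAlgHom _ (SymmetricAlgebra.lift (gradedι k E))
    (by
      refine SymmetricAlgebra.algHom_ext (LinearMap.ext fun e => ?_)
      change DirectSum.coeAlgHom (symGrading k E) (SymmetricAlgebra.lift (gradedι k E)
        (SymmetricAlgebra.ι k E e)) = SymmetricAlgebra.ι k E e
      rw [SymmetricAlgebra.lift_ι_apply, gradedι_apply, DirectSum.coeAlgHom_of])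
    fun i x => by
      obtain ⟨x, hx⟩ := x
      dsimp only [DirectSum.lof_eq_of]
      rw [symGrading] at hx
      induction hx using Submodule.pow_induction_on_left' with
      | algebraMap r =>
        rw [AlgHom.commutes, DirectSum.algebraMap_apply]; rfl
      | add x y i hx' hy' ihx ihy =>
        rw [map_add, ihx hx', ihy hy', ← map_add]
        rfl
      | mem_mul m hm i x hx' ih =>
        obtain ⟨_, rfl⟩ := hm
        rw [map_mul, ih hx', SymmetricAlgebra.lift_ι_apply, gradedι_apply, DirectSum.of_mul_of]
        exact DirectSum.of_eq_of_gradedMonoid_eq (Sigma.subtype_ext (add_comm _ _) rfl)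

instance [FiniteDimensional k E] (d : ℕ) : FiniteDimensional k (symGrading k E d) := by
  rw [FiniteDimensional, Module.Finite.iff_fg, symGrading]
  exact Submodule.FG.pow (Module.Finite.iff_fg.1 inferInstance) d

lemma prod_mem_symGrading (l : List E) :
    (l.map (SymmetricAlgebra.ι k E)).prod ∈ symGrading k E l.length := by
  induction l with
  | nil => exact SetLike.one_mem_graded _
  | cons e l ih =>
    rw [List.map_cons, List.prod_cons, List.length_cons, add_comm]
    exact SetLike.mul_mem_graded (ι_mem_symGrading e) ih

/-- The products spanning the filtration are homogeneous. -/
lemma decompose_mem_symFiltration {v : Prevaluation k E} {s : ℤ} {f : SymmetricAlgebra k E}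
    (hf : f ∈ symFiltration v s) (d : ℕ) :
    (DirectSum.decompose (symGrading k E) f d : SymmetricAlgebra k E) ∈ symFiltration v s := by
  induction hf using Submodule.span_induction with
  | zero => simp
  | add x y _ _ hx hy =>
    rw [DirectSum.decompose_add, DirectSum.add_apply, Submodule.coe_add]
    exact add_mem hx hy
  | smul c x _ hx =>
    rw [DirectSum.decompose_smul]
    exact Submodule.smul_mem _ c hx
  | mem x hx =>
    obtain ⟨l, rfl, hl⟩ := hx
    by_cases h : l.length = d
    · subst h
      rw [DirectSum.decompose_of_mem_same _ (prod_mem_symGrading l)]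
      exact Submodule.subset_span ⟨l, rfl, hl⟩
    · rw [DirectSum.decompose_of_mem_ne _ (prod_mem_symGrading l) h]
      exact zero_mem _

lemma mul_mem_restrictSupport {κ : Type*} {c : κ → ℤ} {r s t : ℤ} {p q : MvPolynomial κ k}
    (hp : p ∈ restrictSupport k {μ | r ≤ Finsupp.weight c μ})
    (hq : q ∈ restrictSupport k {μ | s ≤ Finsupp.weight c μ}) (h : t ≤ r + s) :
    p * q ∈ restrictSupport k {μ | t ≤ Finsupp.weight c μ} := by
  have := Submodule.mul_mem_mul hp hq
  rw [← restrictSupport_add] at this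
  refine restrictSupport_mono _ ?_ this
  rintro _ ⟨μ, hμ, ν, hν, rfl⟩
  change t ≤ Finsupp.weight c (μ + ν)
  rw [map_add]
  exact h.trans (add_le_add hμ hν)

/-- The filtration of `Sym(E)` in terms of the monomials in an adapted basis. -/
lemma mem_symFiltration_iff {κ : Type*} {v : Prevaluation k E} (b : Module.Basis κ k E) (c : κ → ℤ)
    (hb : ∀ f, v.val f = (b.repr f).support.inf fun i => ((c i : ℤ) : WithTop ℤ)) {s : ℤ}
    {f : SymmetricAlgebra k E} :
    f ∈ symFiltration v s ↔ SymmetricAlgebra.equivMvPolynomial b f ∈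
      restrictSupport k {μ | s ≤ Finsupp.weight c μ} := by
  classical
  constructor
  · intro hf
    induction hf using Submodule.span_induction with
    | zero => rw [map_zero]; exact zero_mem _
    | add x y _ _ hx hy => rw [map_add]; exact add_mem hx hy
    | smul c x _ hx => rw [map_smul]; exact Submodule.smul_mem _ c hx
    | mem x hx =>
      obtain ⟨l, rfl, hl⟩ := hx
      induction l generalizing s with
      | nil =>
        have hs : s ≤ 0 := by
          rw [List.map_nil, List.sum_nil] at hl
          exact_mod_cast hl
        rw [List.map_nil, List.prod_nil, map_one, ← C_1, C_apply]
        exact (monomial_mem_restrictSupport k).2 (Or.inl (by simpa using hs))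
      | cons e l ih =>
        rw [List.map_cons, List.prod_cons, map_mul]
        rw [List.map_cons, List.sum_cons] at hl
        cases he : v.val e with
        | top =>
          have h0 : e = 0 := by
            rw [hb, Finset.inf_eq_top_iff] at he
            rw [← b.repr.map_eq_zero_iff, ← Finsupp.support_eq_empty,
              Finset.eq_empty_iff_forall_notMem]
            exact fun i hi => WithTop.coe_ne_top (he i hi)
          rw [h0, map_zero, map_zero, zero_mul]
          exact zero_mem _
        | coe r =>
          rw [he] at hl
          have h1 : ((s - r : ℤ) : WithTop ℤ) ≤ (l.map v.val).sum := by
            revert hl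
            cases (l.map v.val).sum with
            | top => simp
            | coe t =>
              intro hl
              have : s ≤ r + t := by exact_mod_cast hl
              exact_mod_cast (by omega : s - r ≤ t)
          -- The factor `e` accounts for weight `r`, the remaining product for `s - r`.
          refine mul_mem_restrictSupport (r := r) ?_ (ih h1) (by omega)
          rw [← b.linearCombination_repr e, Finsupp.linearCombination_apply, Finsupp.sum, map_sum,
            map_sum]
          refine Submodule.sum_mem _ fun i hi => ?_
          rw [map_smul, map_smul, SymmetricAlgebra.equivMvPolynomial_ι_apply]
          refine Submodule.smul_mem _ _ ((monomial_mem_restrictSupport k).2 (Or.inl ?_))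
          change r ≤ Finsupp.weight c (Finsupp.single i 1)
          rw [Finsupp.weight_single, one_smul, ← WithTop.coe_le_coe, ← he, hb]
          exact Finset.inf_le hi
  · intro hf
    rw [← (SymmetricAlgebra.equivMvPolynomial b).symm_apply_apply f]
    generalize SymmetricAlgebra.equivMvPolynomial b f = p at hf
    -- A monomial is a product of basis vectors, whose values are the `c i`, so it lies in the step
    -- given by its weight.
    have key : ∀ μ : κ →₀ ℕ, (SymmetricAlgebra.equivMvPolynomial b).symm (monomial μ (1 : k)) ∈
        symFiltration v (Finsupp.weight c μ) := by
      intro μ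
      induction μ using finsupp_nat_induction with
      | zero =>
        rw [map_zero, show (monomial (0 : κ →₀ ℕ) (1 : k)) = 1 from rfl, map_one]
        exact symFiltration_one v
      | add μ ν h h' =>
        rw [map_add, ← one_mul (1 : k), ← monomial_mul, map_mul]
        exact symFiltration_mul v _ _ _ _ h h'
      | single i =>
        rw [Finsupp.weight_single, one_smul]
        refine Submodule.subset_span ⟨[b i], ?_, ?_⟩
        · exact (SymmetricAlgebra.equivMvPolynomial_symm_X b i).trans (by simp)
        · rw [List.map_singleton, List.sum_singleton, hb, b.repr_self,
            Finsupp.support_single _ one_ne_zero, Finset.inf_singleton]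
    rw [restrictSupport_eq_span] at hf
    induction hf using Submodule.span_induction with
    | zero => rw [map_zero]; exact zero_mem _
    | add x y _ _ hx hy => rw [map_add]; exact add_mem hx hy
    | smul c x _ hx => rw [map_smul]; exact Submodule.smul_mem _ c hx
    | mem x hx =>
      obtain ⟨μ, hμ, rfl⟩ := hx
      exact symFiltration_anti v hμ (key μ)

lemma weight_apply {κ N : Type*} [AddCommGroup N] (m : κ → N →ₗ[ℤ] ℤ) (μ : κ →₀ ℕ) (x : N) :
    Finsupp.weight m μ x = Finsupp.weight (fun i => m i x) μ := by
  induction μ using finsupp_nat_induction with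
  | zero => simp
  | add _ _ h h' => rw [map_add, map_add, LinearMap.add_apply, h, h']
  | single i => rw [Finsupp.weight_single, Finsupp.weight_single, one_smul, one_smul]

/-- The symmetric algebra of a toric vector bundle is a flat toric sheaf of algebras. -/
lemma ToricBundle.isFlatToric {N : Type*} [AddCommGroup N] {F : SmoothFan N}
    (𝓔 : ToricBundle F k E) : F.IsFlatToric (symGrading k E) 𝓔.val where
  homogeneous := fun x f d => le_of_forall_int_le fun s hs =>
    mem_level_symVal.2 (decompose_mem_symFiltration (mem_level_symVal.1 hs) d)
  adapted := fun s hs => by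
    obtain ⟨κ, b, m, hb⟩ := 𝓔.adapted s hs
    -- The adapted basis consists of the monomials, and the linear form of `μ` is `∑ μ_i m_i`. The
    -- lift puts the exponents into the universe of `Sym(E)`.
    refine ⟨ULift (κ →₀ ℕ), b.symmetricAlgebra.reindex Equiv.ulift.symm,
      fun μ => Finsupp.weight m μ.down, fun x hx f => ?_⟩
    have key : ∀ r : ℤ, (r : WithTop ℤ) ≤ (𝓔.val x).val f ↔
        ∀ μ ∈ (SymmetricAlgebra.equivMvPolynomial b f).support,
          r ≤ Finsupp.weight (fun i => m i x.1) μ := fun r =>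
      mem_level_symVal.trans (mem_symFiltration_iff b (fun i => m i x.1) (hb x hx))
    have hsupp : ∀ μ : ULift (κ →₀ ℕ),
        μ ∈ ((b.symmetricAlgebra.reindex Equiv.ulift.symm).repr f).support ↔
          μ.down ∈ (SymmetricAlgebra.equivMvPolynomial b f).support := by
      intro μ
      rw [Finsupp.mem_support_iff, Module.Basis.repr_reindex_apply, mem_support_iff]
      rfl
    have key' : ∀ r : ℤ, (r : WithTop ℤ) ≤
        ((b.symmetricAlgebra.reindex Equiv.ulift.symm).repr f).support.inf
          (fun μ => ((Finsupp.weight m μ.down x.1 : ℤ) : WithTop ℤ)) ↔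
        (r : WithTop ℤ) ≤ (𝓔.val x).val f := by
      intro r
      rw [Finset.le_inf_iff, key]
      constructor
      · intro h μ hμ
        have := h ⟨μ⟩ ((hsupp _).2 hμ)
        rwa [WithTop.coe_le_coe, weight_apply] at this
      · intro h μ hμ
        rw [WithTop.coe_le_coe, weight_apply]
        exact h _ ((hsupp _).1 hμ)
    exact le_antisymm (le_of_forall_int_le fun r h => (key' r).2 h)
      (le_of_forall_int_le fun r h => (key' r).1 h)

end Symmetric

/-! ### From the algorithm to the main theorem -/

section MainTheorem

variable {k : Type*} [Field k] {N : Type*} [AddCommGroup N] {F : SmoothFan N} {n : ℕ}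
  (ρ : Fin n ≃ F.Ray) {A : Type*} [CommRing A] [Algebra k A] {𝒜 : ℕ → Submodule k A}
  [GradedAlgebra 𝒜] {v : F.Point → Quasivaluation k A} {B : Finset A}

lemma SmoothFan.IsFlatToric.exists_stageGenerators (hv : F.IsFlatToric 𝒜 v)
    (hB : IsHomogeneousGenerators 𝒜 B)
    (h : CanTerminate 𝒜 (fun i => v (ρ i).point) (initialState n B)) :
    ∃ B', IsStageGenerators 𝒜 (fun i => v (ρ i).point) n B' :=
  exists_stageGenerators_of_canTerminate
    (fun i _ => SmoothFan.eq_zero_of_val hv.adapted (ρ i).point) hB h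

lemma SmoothFan.IsFlatToric.terminates_of_fg [∀ d, FiniteDimensional k (𝒜 d)]
    (hv : F.IsFlatToric 𝒜 v) (hB : IsHomogeneousGenerators 𝒜 B)
    (h : (partialRees (fun i => v (ρ i).point) n).FG) :
    Terminates 𝒜 (fun i => v (ρ i).point) (initialState n B) :=
  StrongKhovanskii.terminates_of_fg
    (fun i _ => SmoothFan.eq_zero_of_val hv.adapted (ρ i).point)
    (fun i => hv.homogeneous (ρ i).point) h n 0 (zero_add n) _ (invariant_initialState hB)

end MainTheorem

end

end StrongKhovanskii

theorem mainTheorem7 {k : Type*} [Field k] [IsAlgClosed k]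
    {N : Type*} [AddCommGroup N] [Module.Free ℤ N] [Module.Finite ℤ N]
    (F : SmoothFan N) {n : ℕ} (ρ : Fin n ≃ F.Ray) :
    (∀ {A : Type*} [CommRing A] [Algebra k A] (𝒜 : ℕ → Submodule k A) [GradedAlgebra 𝒜]
        [∀ d, FiniteDimensional k (𝒜 d)]
        (v : F.Point → Quasivaluation k A), F.IsFlatToric 𝒜 v →
      ∀ B : Finset A, IsHomogeneousGenerators 𝒜 B →
        (∀ (j : ℕ) (B' : Finset (Laurent A n)),
          Relation.ReflTransGen (Step 𝒜 fun i => v (ρ i).point) (initialState n B)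
              (State.stage j B') →
            Algebra.adjoin k (B' : Set (Laurent A n)) =
              partialRees (fun i => v (ρ i).point) j) ∧
        [Terminates 𝒜 (fun i => v (ρ i).point) (initialState n B),
          CanTerminate 𝒜 (fun i => v (ρ i).point) (initialState n B),
          ∃ C : Set A, C.Finite ∧ F.IsStrongKhovanskiiBasis v C].TFAE) ∧
    (∀ {E : Type*} [AddCommGroup E] [Module k E] (𝓔 : ToricBundle F k E)
        (B : Finset (SymmetricAlgebra k E)), IsHomogeneousGenerators (symGrading k E) B →
      [Terminates (symGrading k E) (fun i => 𝓔.val (ρ i).point) (initialState n B),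
        CanTerminate (symGrading k E) (fun i => 𝓔.val (ρ i).point) (initialState n B),
        Algebra.FiniteType k 𝓔.coxRing].TFAE) := by
  refine ⟨fun {A} _ _ 𝒜 _ _ v hv B hB => ⟨fun j B' h => ?_, ?_⟩, fun {E} _ _ 𝓔 B hB => ?_⟩
  · exact IsStageGenerators.adjoin_eq (invariant_of_reflTransGen
      (fun i _ => SmoothFan.eq_zero_of_val hv.adapted (ρ i).point) h (invariant_initialState hB))
  · tfae_have 1 → 2 := Terminates.canTerminate
    tfae_have 2 → 3 := fun h =>
      have ⟨_, hB'⟩ := hv.exists_stageGenerators ρ hB h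
      SmoothFan.exists_finite_strongKhovanskiiBasis ρ hv.adapted hB'
    tfae_have 3 → 1 := fun ⟨_, hC, h⟩ =>
      hv.terminates_of_fg ρ hB (SmoothFan.fg_of_strongKhovanskiiBasis ρ hv.adapted hC h)
    tfae_finish
  · have hv := 𝓔.isFlatToric
    have := 𝓔.finite
    have iff : (partialRees (fun i => 𝓔.val (ρ i).point) n).FG ↔ Algebra.FiniteType k 𝓔.coxRing :=
      (SmoothFan.fg_totalSections_iff ρ hv.adapted).symm.trans (Subalgebra.fg_iff_finiteType _)
    tfae_have 1 → 2 := Terminates.canTerminate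
    tfae_have 2 → 3 := fun h =>
      have ⟨_, hB'⟩ := hv.exists_stageGenerators ρ hB h
      iff.1 hB'.fg
    tfae_have 3 → 1 := fun h => hv.terminates_of_fg ρ hB (iff.2 h)
    tfae_finish
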